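/- For a finite simple graph $G$ and a set $X\subseteq V(G)$, let $\mathrm{cl}(X)$ (resp. $\mathrm{ind}(X)$) say that $X$ is a clique (resp. an independent set), the empty set and singletons included. Let $\mathrm{maxcl}(X)$ say that $X$ is a clique and no vertex outside $X$ is adjacent to all vertices of $X$, and let $\mathrm{maxind}(X)$ say that $X$ is independent and every vertex outside $X$ is adjacent to some vertex of $X$. Let $\varphi_C(X)$ say that some vertex outside $X$ is adjacent to no vertex of $X$, and $\varphi_I(X)$ that some vertex outside $X$ is adjacent to every vertex of $X$. Consider the following sentences, in which $X$ ranges over all sets of vertices: $$\varphi^1_C=\forall X\,[\mathrm{cl}(X)\to\varphi_C(X)],\quad \varphi^2_C=\forall X\,[\mathrm{maxcl}(X)\to\neg\varphi_C(X)],\quad \varphi^3_C=\forall X\,[(\mathrm{cl}(X)\wedge\neg\varphi_C(X))\to\mathrm{maxcl}(X)],$$ $$\varphi^1_I=\forall X\,[\mathrm{ind}(X)\to\varphi_I(X)],\quad \varphi^2_I=\forall X\,[\mathrm{maxind}(X)\to\neg\varphi_I(X)],\quad \varphi^3_I=\forall X\,[(\mathrm{ind}(X)\wedge\neg\varphi_I(X))\to\mathrm{maxind}(X)].$$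 Let $p\in(0,1)$ be a constant, and let $G(n,p)$ be the random graph on $n$ labelled vertices in which each pair of vertices is joined by an edge independently with probability $p$. 1. If $p>\frac{3-\sqrt5}{2}$, then $\mathsf P(G(n,p)\models\neg\varphi^1_C\wedge\neg\varphi^2_C\wedge\neg\varphi^3_C)\to1$ as $n\to\infty$. 2. If $p<\frac{3-\sqrt5}{2}$, then $\mathsf P(G(n,p)\models\varphi^1_C)\to1$ as $n\to\infty$. 3. If $p=\frac{3-\sqrt5}{2}$, then $\mathsf P(G(n,p)\models\varphi^3_C)$ does not converge as $n\to\infty$. 4. If $p<\frac{\sqrt5-1}{2}$, then $\mathsf P(G(n,p)\models\neg\varphi^1_I\wedge\neg\varphi^2_I\wedge\neg\varphi^3_I)\to1$ as $n\to\infty$. 5. If $p>\frac{\sqrt5-1}{2}$, then $\mathsf P(G(n,p)\models\varphi^1_I)\to1$ as $n\to\infty$. 6. If $p=\frac{\sqrt5-1}{2}$, then $\mathsf P(G(n,p)\models\varphi^3_I)$ does not converge as $n\to\infty$. -/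

import Mathlib

namespace CliqueSentences

variable {V : Type*}

/-- `X` is a maximal clique: a clique such that no vertex outside `X` is adjacent to all of `X`. -/
def MaxCl (G : SimpleGraph V) (X : Set V) : Prop :=
  G.IsClique X ∧ ¬ ∃ x, x ∉ X ∧ ∀ y, y ∈ X → G.Adj x y

/-- `φ_C(X)`: some vertex outside `X` is not adjacent to any vertex of `X`. -/
def PhiC (G : SimpleGraph V) (X : Set V) : Prop :=
  ∃ x, x ∉ X ∧ ∀ y, y ∈ X → ¬ G.Adj x y

/-- `G ⊨ φ¹_C`. The monadic quantifier `∀ X` ranges over all sets of vertices. -/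
def PhiC1 (G : SimpleGraph V) : Prop :=
  ∀ X : Set V, G.IsClique X → PhiC G X

/-- `G ⊨ φ²_C`. -/
def PhiC2 (G : SimpleGraph V) : Prop :=
  ∀ X : Set V, MaxCl G X → ¬ PhiC G X

/-- `G ⊨ φ³_C`. -/
def PhiC3 (G : SimpleGraph V) : Prop :=
  ∀ X : Set V, G.IsClique X ∧ ¬ PhiC G X → MaxCl G X

/-- `X` is a maximal independent set: an independent set such that every vertex outside `X` has
a neighbour in `X`. -/
def MaxInd (G : SimpleGraph V) (X : Set V) : Prop :=
  G.IsIndepSet X ∧ ¬ ∃ x, x ∉ X ∧ ∀ y, y ∈ X → ¬ G.Adj x y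

/-- `φ_I(X)`: some vertex outside `X` is adjacent to every vertex of `X`. -/
def PhiI (G : SimpleGraph V) (X : Set V) : Prop :=
  ∃ x, x ∉ X ∧ ∀ y, y ∈ X → G.Adj x y

/-- `G ⊨ φ¹_I`. -/
def PhiI1 (G : SimpleGraph V) : Prop :=
  ∀ X : Set V, G.IsIndepSet X → PhiI G X

/-- `G ⊨ φ²_I`. -/
def PhiI2 (G : SimpleGraph V) : Prop :=
  ∀ X : Set V, MaxInd G X → ¬ PhiI G X

/-- `G ⊨ φ³_I`. -/
def PhiI3 (G : SimpleGraph V) : Prop :=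
  ∀ X : Set V, G.IsIndepSet X ∧ ¬ PhiI G X → MaxInd G X

/-- The probability that the binomial random graph `G(n, p)` on `n` labelled vertices has the
property `Q`. -/
noncomputable def prob (n : ℕ) (p : unitInterval) (Q : SimpleGraph (Fin n) → Prop) : ℝ :=
  (SimpleGraph.binomialRandom (Fin n) p).real {G | Q G}

end CliqueSentences

/-! Put q = 1 - p and y = n q^k. A violation of φ¹_C is a clique X having a neighbour of every
outside vertex. The expected number of these of size k is at most a constant times (p/q²)^(k choose
2) q^(-k) · y^k e^(-y)/k!. The Poisson factor is at most 1, so the comparison of p with q² decides;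
p = q² has the root (3-√5)/2 in (0,1).

If p < q², the bounds are summable in k and each term vanishes as n grows, so the first moment
suffices (`tendsto_prob_phiC1`).

If p > q², take k = ⌊γ log n⌋ with γ so large that almost surely no given k-set is missed by, or
completely joined to, some outside vertex, yet so small that k-cliques abound. A second moment
argument, `le_prob_hasRootedClique`, finds such cliques completely joined to a fixed vertex, which
refute φ¹_C and φ³_C, and others not joined to it at all, which refute φ²_C.

If p = q², a violation of φ³_C is in essence a dominating k-clique X with a vertex x extending it,
and the expected number of pairs (X, x) is about y^(k+1) e^(-y)/k!. This is exponentially small in k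
unless y is near k. Raising k by one multiplies y by q, so n can be chosen so that y/k avoids a
neighbourhood of 1 for every k (`tendsto_prob_phiC3_sparseOrder`), or so that y lies within 1 of
some k. In the latter case the expectation is bounded below and correlations cost a constant factor,
so a violation has probability bounded away from 0 (`DenseRegime.le_prob_not_phiC3`). The two
subsequences preclude a limit.

Complementation carries G(n,p) to G(n,1-p) and exchanges the two families of sentences. -/

namespace CliqueSentences

open MeasureTheory ProbabilityTheory Filter Topology
open scoped unitInterval

/-! ### Independence of edge events in the binomial random graph. -/

section Edges

variable {V : Type*}

/-- The event that `e` is an edge. -/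
def edgeEvent (e : Sym2 V) : Set (SimpleGraph V) := {G | e ∈ G.edgeSet}

/-- The event `A` is determined by the edges in `S`. -/
def DependsOnEdges (S : Set (Sym2 V)) (A : Set (SimpleGraph V)) : Prop :=
  MeasurableSet[⨆ e ∈ S, MeasurableSpace.generateFrom {edgeEvent e}] A

lemma DependsOnEdges.mono {S T : Set (Sym2 V)} (h : S ⊆ T) {A : Set (SimpleGraph V)}
    (hA : DependsOnEdges S A) : DependsOnEdges T A := by
  have : (⨆ e ∈ S, MeasurableSpace.generateFrom {edgeEvent e}) ≤
      ⨆ e ∈ T, MeasurableSpace.generateFrom {edgeEvent e} := biSup_mono h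
  exact this _ hA

lemma DependsOnEdges.compl {S : Set (Sym2 V)} {A : Set (SimpleGraph V)}
    (hA : DependsOnEdges S A) : DependsOnEdges S Aᶜ :=
  MeasurableSet.compl hA

lemma DependsOnEdges.inter {S : Set (Sym2 V)} {A B : Set (SimpleGraph V)}
    (hA : DependsOnEdges S A) (hB : DependsOnEdges S B) : DependsOnEdges S (A ∩ B) :=
  MeasurableSet.inter hA hB

lemma DependsOnEdges.biInter {ι : Type*} {S : Set (Sym2 V)} (s : Finset ι)
    {A : ι → Set (SimpleGraph V)} (hA : ∀ i ∈ s, DependsOnEdges S (A i)) :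
    DependsOnEdges S (⋂ i ∈ s, A i) :=
  Finset.measurableSet_biInter s hA

lemma dependsOnEdges_univ (S : Set (Sym2 V)) : DependsOnEdges S Set.univ :=
  MeasurableSet.univ

lemma dependsOnEdges_edgeEvent {S : Set (Sym2 V)} {e : Sym2 V} (he : e ∈ S) :
    DependsOnEdges S (edgeEvent e) := by
  have : MeasurableSpace.generateFrom {edgeEvent e} ≤
      ⨆ e ∈ S, MeasurableSpace.generateFrom {edgeEvent e} :=
    le_biSup (fun e => MeasurableSpace.generateFrom {edgeEvent e}) he
  exact this _ (MeasurableSpace.measurableSet_generateFrom rfl)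

lemma dependsOnEdges_present (F : Finset (Sym2 V)) :
    DependsOnEdges (F : Set (Sym2 V)) (⋂ e ∈ F, edgeEvent e) :=
  DependsOnEdges.biInter F fun _ he => dependsOnEdges_edgeEvent he

variable [Finite V]

instance measurableSingletonClass_simpleGraph : MeasurableSingletonClass (SimpleGraph V) where
  measurableSet_singleton G := by
    have : ({G} : Set (SimpleGraph V)) = SimpleGraph.edgeSet ⁻¹' {G.edgeSet} := by
      ext H; simp
    rw [this]
    exact SimpleGraph.measurableEmbedding_edgeSet.measurable (measurableSet_singleton _)

lemma measurableSet_of_finite_graph (A : Set (SimpleGraph V)) : MeasurableSet A :=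
  (Set.toFinite A).measurableSet

variable (p : I)

/-- The random graph is an image of a product measure over pairs, under which the event is a box. -/
lemma binomialRandom_present (F : Finset (Sym2 V)) (hF : ∀ e ∈ F, ¬ e.IsDiag) :
    (SimpleGraph.binomialRandom V p) (⋂ e ∈ F, edgeEvent e) =
      (unitInterval.toNNReal p : ENNReal) ^ F.card := by
  classical
  have h1 : (⋂ e ∈ F, edgeEvent e : Set (SimpleGraph V)) = {G | ∀ e ∈ F, e ∈ G.edgeSet} := by
    ext G; simp [edgeEvent]
  rw [h1, SimpleGraph.binomialRandom_eq_map, Measure.map_apply SimpleGraph.measurable_fromEdgeSet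
    (measurableSet_of_finite_graph _), setBernoulli_apply']
  have h2 : ((fun q : Sym2 V → Prop => {i | q i}) ⁻¹' (SimpleGraph.fromEdgeSet ⁻¹'
      {G : SimpleGraph V | ∀ e ∈ F, e ∈ G.edgeSet})) = Set.pi (F : Set (Sym2 V)) (fun _ => {True}) := by
    ext f
    simp only [Set.mem_preimage, Set.mem_ofPred_eq, Set.mem_pi, Finset.mem_coe,
      Set.mem_singleton_iff, SimpleGraph.edgeSet_fromEdgeSet, Set.mem_sdiff]
    refine forall₂_congr fun e he => ?_
    simp [hF e he]
  rw [h2, Measure.infinitePi_pi _ (fun i hi => (Set.toFinite _).measurableSet), ← Finset.prod_const]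
  refine Finset.prod_congr rfl fun e he => ?_
  simp [hF e he]

lemma iIndepSet_edgeEvent :
    iIndepSet (edgeEvent : Sym2 V → Set (SimpleGraph V)) (SimpleGraph.binomialRandom V p) := by
  classical
  rw [iIndepSet_iff_meas_biInter fun _ => measurableSet_of_finite_graph _]
  intro s
  by_cases hs : ∀ e ∈ s, ¬ e.IsDiag
  · rw [binomialRandom_present p s hs, ← Finset.prod_const]
    refine Finset.prod_congr rfl fun e he => ?_
    have := binomialRandom_present p {e} (by simpa using hs e he)
    simpa using this.symm
  -- A diagonal pair is never an edge, so both sides are zero.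
  · push Not at hs
    obtain ⟨e, he, hd⟩ := hs
    have h0 : (edgeEvent e : Set (SimpleGraph V)) = ∅ := by
      ext G
      simp only [edgeEvent, Set.mem_ofPred_eq, Set.mem_empty_iff_false, iff_false]
      exact fun h => G.not_isDiag_of_mem_edgeSet h hd
    rw [Finset.prod_eq_zero he (by simp [h0])]
    refine measure_mono_null (t := edgeEvent e) (Set.biInter_subset_of_mem he) (by simp [h0])

/-- The σ-algebras generated by disjoint subfamilies of independent events are independent. -/
lemma DependsOnEdges.real_inter {S T : Set (Sym2 V)} (hST : Disjoint S T)
    {A B : Set (SimpleGraph V)} (hA : DependsOnEdges S A) (hB : DependsOnEdges T B) :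
    (SimpleGraph.binomialRandom V p).real (A ∩ B) =
      (SimpleGraph.binomialRandom V p).real A * (SimpleGraph.binomialRandom V p).real B := by
  have h := indep_iSup_of_disjoint (fun e => ?_) ((iIndepSet_iff_iIndep _ _).1
    (iIndepSet_edgeEvent (V := V) p)) hST
  · rw [Indep_iff] at h
    simp only [Measure.real]
    rw [h A B hA hB, ENNReal.toReal_mul]
  · intro s _
    exact measurableSet_of_finite_graph s

lemma real_inter_biInter {ι : Type*} (s : Finset ι) {S : Set (Sym2 V)} {A : Set (SimpleGraph V)}
    (hA : DependsOnEdges S A) (T : ι → Set (Sym2 V)) (B : ι → Set (SimpleGraph V))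
    (hB : ∀ i ∈ s, DependsOnEdges (T i) (B i)) (hST : ∀ i ∈ s, Disjoint S (T i))
    (hTT : ∀ i ∈ s, ∀ j ∈ s, i ≠ j → Disjoint (T i) (T j)) :
    (SimpleGraph.binomialRandom V p).real (A ∩ ⋂ i ∈ s, B i) =
      (SimpleGraph.binomialRandom V p).real A *
        ∏ i ∈ s, (SimpleGraph.binomialRandom V p).real (B i) := by
  classical
  induction s using Finset.induction_on with
  | empty => simp
  | insert a s ha ih =>
    rw [Finset.set_biInter_insert, Finset.prod_insert ha, Set.inter_left_comm]
    have hd : DependsOnEdges (S ∪ ⋃ i ∈ s, T i) (A ∩ ⋂ i ∈ s, B i) :=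
      (hA.mono Set.subset_union_left).inter (DependsOnEdges.biInter s fun i hi =>
        (hB i (Finset.mem_insert_of_mem hi)).mono
          ((Set.subset_biUnion_of_mem (u := T) (s := (s : Set ι)) hi).trans Set.subset_union_right))
    rw [(hB a (Finset.mem_insert_self a s)).real_inter p ?_ hd, ih]
    · ring
    · exact fun i hi => hB i (Finset.mem_insert_of_mem hi)
    · exact fun i hi => hST i (Finset.mem_insert_of_mem hi)
    · exact fun i hi j hj => hTT i (Finset.mem_insert_of_mem hi) j (Finset.mem_insert_of_mem hj)
    · rw [Set.disjoint_union_right, Set.disjoint_iUnion₂_right]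
      refine ⟨(hST a (Finset.mem_insert_self a s)).symm, fun i hi => ?_⟩
      exact hTT a (Finset.mem_insert_self a s) i (Finset.mem_insert_of_mem hi)
        (fun h => ha (h ▸ hi))

lemma real_present (F : Finset (Sym2 V)) (hF : ∀ e ∈ F, ¬ e.IsDiag) :
    (SimpleGraph.binomialRandom V p).real (⋂ e ∈ F, edgeEvent e) = (p : ℝ) ^ F.card := by
  rw [Measure.real, binomialRandom_present p F hF]
  simp

lemma real_absent (F : Finset (Sym2 V)) (hF : ∀ e ∈ F, ¬ e.IsDiag) :
    (SimpleGraph.binomialRandom V p).real (⋂ e ∈ F, (edgeEvent e)ᶜ) = (1 - p : ℝ) ^ F.card := by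
  have := real_inter_biInter p F (dependsOnEdges_univ (V := V) ∅) (fun e => {e})
    (fun e => (edgeEvent e)ᶜ)
    (fun e _ => (dependsOnEdges_edgeEvent (Set.mem_singleton e)).compl) (by simp)
    (fun i _ j _ hij => by simpa using hij)
  rw [Set.univ_inter] at this
  rw [this, probReal_univ, one_mul, ← Finset.prod_const]
  refine Finset.prod_congr rfl fun e he => ?_
  rw [probReal_compl_eq_one_sub (measurableSet_of_finite_graph _)]
  have := real_present p {e} (by simpa using hF e he)
  simp only [Finset.mem_singleton, Set.iInter_iInter_eq_left, Finset.card_singleton, pow_one] at this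
  rw [this]

end Edges

/-! ### Complementation exchanges p and 1 - p. -/

section Complement

lemma real_compl_graph {V : Type*} [Finite V] (p : I) (Q : SimpleGraph V → Prop) :
    (SimpleGraph.binomialRandom V p).real {G | Q Gᶜ} =
      (SimpleGraph.binomialRandom V (σ p)).real {G | Q G} := by
  classical
  cases nonempty_fintype V
  have : Fintype (SimpleGraph V) := Fintype.ofFinite _
  have key : ∀ (p : I) (S : Set (SimpleGraph V)), (SimpleGraph.binomialRandom V p).real S =
      ∑ G ∈ S.toFinset, (SimpleGraph.binomialRandom V p).real {G} := by
    intro p S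
    rw [sum_measureReal_singleton]
    simp
  rw [key, key]
  refine Finset.sum_bij (fun G _ => Gᶜ) (by simp) (by simp) ?_ ?_
  · intro G hG
    exact ⟨Gᶜ, by simpa using hG, by simp⟩
  · intro G _
    simp only [Measure.real, SimpleGraph.binomialRandom_singleton]
    -- The edges of G and of its complement partition the pairs, so passing to the complement swaps
    -- the exponents of p and 1 - p in the weight of a single graph.
    have hc : G.edgeSet.ncard + Gᶜ.edgeSet.ncard = (Nat.card V).choose 2 := by
      have hd : Disjoint G.edgeSet Gᶜ.edgeSet := by
        rw [SimpleGraph.disjoint_edgeSet]; exact disjoint_compl_right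
      rw [← Set.ncard_union_eq hd, ← SimpleGraph.edgeSet_sup, sup_compl_eq_top,
        Nat.card_eq_fintype_card, ← SimpleGraph.card_edgeFinset_top_eq_card_choose_two,
        ← Set.ncard_coe_finset]
      simp
    rw [← hc]
    simp only [add_tsub_cancel_left, unitInterval.symm_symm, add_tsub_cancel_right]
    rw [mul_comm]

end Complement

/-! ### The second moment method. -/

section SecondMoment

/-- The second moment inequality for a finite family of events. -/
lemma sq_sum_le_real_biUnion_mul {Ω ι : Type*} [Finite Ω] [MeasurableSpace Ω]
    [MeasurableSingletonClass Ω] (μ : Measure Ω) [IsFiniteMeasure μ] (s : Finset ι)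
    (A : ι → Set Ω) :
    (∑ i ∈ s, μ.real (A i)) ^ 2 ≤
      μ.real (⋃ i ∈ s, A i) * ∑ i ∈ s, ∑ j ∈ s, μ.real (A i ∩ A j) := by
  classical
  cases nonempty_fintype Ω
  have key : ∀ S : Set Ω, μ.real S = ∑ x : Ω, μ.real {x} * S.indicator 1 x := by
    intro S
    have : μ.real S = ∑ x ∈ S.toFinset, μ.real {x} := by
      rw [sum_measureReal_singleton]; simp
    rw [this]
    simp only [Set.indicator_apply, Pi.one_apply, mul_ite, mul_one, mul_zero]
    rw [← Finset.sum_filter]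
    congr 1
    ext; simp
  set N : Ω → ℝ := fun x => ∑ i ∈ s, (A i).indicator 1 x with hN
  set U : Set Ω := ⋃ i ∈ s, A i with hU
  -- The counting variable N vanishes off the union U, so E N = E(1_U N). Splitting the weight of
  -- each point into two square roots prepares Cauchy–Schwarz.
  have h1 : ∑ i ∈ s, μ.real (A i) =
      ∑ x : Ω, (√(μ.real {x}) * U.indicator 1 x) * (√(μ.real {x}) * N x) := by
    simp_rw [key (A _)]
    rw [Finset.sum_comm]
    refine Finset.sum_congr rfl fun x _ => ?_
    have hs : √(μ.real {x}) * √(μ.real {x}) = μ.real {x} := Real.mul_self_sqrt measureReal_nonneg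
    have : U.indicator 1 x * N x = N x := by
      by_cases hx : x ∈ U
      · simp [hx]
      · have : N x = 0 := by
          refine Finset.sum_eq_zero fun i hi => ?_
          have : x ∉ A i := fun h => hx (Set.mem_biUnion hi h)
          simp [this]
        simp [this]
    calc ∑ i ∈ s, μ.real {x} * (A i).indicator 1 x = μ.real {x} * N x := by
          rw [hN, Finset.mul_sum]
      _ = μ.real {x} * (U.indicator 1 x * N x) := by rw [this]
      _ = (√(μ.real {x}) * √(μ.real {x})) * (U.indicator 1 x * N x) := by rw [hs]
      _ = _ := by ring
  have h2 : ∑ i ∈ s, ∑ j ∈ s, μ.real (A i ∩ A j) = ∑ x : Ω, (√(μ.real {x}) * N x) ^ 2 := by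
    simp_rw [key (A _ ∩ A _)]
    rw [Finset.sum_congr rfl (fun i _ => Finset.sum_comm), Finset.sum_comm]
    refine Finset.sum_congr rfl fun x _ => ?_
    rw [mul_pow, Real.sq_sqrt measureReal_nonneg, hN, sq, Finset.sum_mul_sum, Finset.mul_sum]
    refine Finset.sum_congr rfl fun i _ => ?_
    rw [Finset.mul_sum]
    refine Finset.sum_congr rfl fun j _ => ?_
    by_cases hi : x ∈ A i <;> by_cases hj : x ∈ A j <;> simp [hi, hj]
  have h3 : μ.real U = ∑ x : Ω, (√(μ.real {x}) * U.indicator 1 x) ^ 2 := by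
    rw [key U]
    refine Finset.sum_congr rfl fun x _ => ?_
    rw [mul_pow, Real.sq_sqrt measureReal_nonneg]
    by_cases hx : x ∈ U <;> simp [hx]
  rw [h1, h2, h3]
  exact Finset.sum_mul_sq_le_sq_mul_sq _ _ _

end SecondMoment

/-! ### Probabilities of clique, adjacency and domination events. -/

section Events

variable {V : Type*} [DecidableEq V]

/-- The pairs of distinct elements of `X`. -/
def pairs (X : Finset V) : Finset (Sym2 V) := X.sym2.filter fun e => ¬ e.IsDiag

/-- The pairs consisting of `z` and an element of `X`. -/
def star (z : V) (X : Finset V) : Finset (Sym2 V) := X.image fun x => s(z, x)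

/-- The event that `X` is a clique. -/
def cliqueEvent (X : Finset V) : Set (SimpleGraph V) := {G | G.IsClique (X : Set V)}

/-- The event that `z` is adjacent to all (`b = true`) or to none (`b = false`) of `X`. -/
def uniformEvent (b : Bool) (z : V) (X : Finset V) : Set (SimpleGraph V) :=
  {G | ∀ x ∈ X, (G.Adj z x ↔ b = true)}

lemma not_isDiag_of_mem_pairs {X : Finset V} {e : Sym2 V} (he : e ∈ pairs X) : ¬ e.IsDiag :=
  (Finset.mem_filter.1 he).2

lemma not_isDiag_of_mem_star {z : V} {X : Finset V} (hz : z ∉ X) {e : Sym2 V} (he : e ∈ star z X) :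
    ¬ e.IsDiag := by
  obtain ⟨x, hx, rfl⟩ := Finset.mem_image.1 he
  rw [Sym2.mk_isDiag_iff]
  rintro rfl
  exact hz hx

lemma card_pairs (X : Finset V) : (pairs X).card = X.card.choose 2 := by
  have h := Finset.card_sym2 X
  have h1 : X.sym2.filter (fun e => e.IsDiag) = X.image Sym2.diag := by
    ext e
    induction e with | _ a b
    simp only [Finset.mem_filter, Finset.mk_mem_sym2_iff, Sym2.mk_isDiag_iff, Finset.mem_image,
      Sym2.diag]
    constructor
    · rintro ⟨⟨ha, hb⟩, rfl⟩; exact ⟨a, ha, rfl⟩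
    · rintro ⟨c, hc, h⟩
      simp at h
      grind
  have h2 : (X.image Sym2.diag).card = X.card :=
    Finset.card_image_of_injective _ Sym2.diag_injective
  have h3 := Finset.card_filter_add_card_filter_not (s := X.sym2) (fun e => e.IsDiag)
  rw [h1, h2, h, Nat.choose_succ_succ' X.card 1, Nat.choose_one_right] at h3
  unfold pairs
  simp at h3 ⊢
  omega

lemma pairs_inter (X Y : Finset V) : pairs X ∩ pairs Y = pairs (X ∩ Y) := by
  ext e
  induction e with | _ a b
  simp [pairs]
  tauto

lemma pairs_union_subset (X Y : Finset V) : pairs X ∪ pairs Y ⊆ pairs (X ∪ Y) := by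
  intro e
  induction e with | _ a b
  simp [pairs]
  tauto

lemma card_pairs_union (X Y : Finset V) :
    (pairs X ∪ pairs Y).card + (X ∩ Y).card.choose 2 =
      X.card.choose 2 + Y.card.choose 2 := by
  rw [← card_pairs, ← card_pairs, ← card_pairs, ← pairs_inter, Finset.card_union_add_card_inter]

lemma card_star (z : V) (X : Finset V) : (star z X).card = X.card :=
  Finset.card_image_of_injective _ fun _ _ h => Sym2.congr_right.1 h

lemma disjoint_pairs_star {X Y : Finset V} {z : V} (hz : z ∉ X) :
    Disjoint (pairs X : Set (Sym2 V)) (star z Y) := by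
  rw [Set.disjoint_left]
  intro e he hs
  obtain ⟨y, -, rfl⟩ := Finset.mem_image.1 (Finset.mem_coe.1 hs)
  have := (Finset.mem_filter.1 (Finset.mem_coe.1 he)).1
  rw [Finset.mk_mem_sym2_iff] at this
  exact hz this.1

lemma disjoint_star_star {X Y : Finset V} {z w : V} (hzw : z ≠ w) (hz : z ∉ Y) :
    Disjoint (star z X : Set (Sym2 V)) (star w Y) := by
  rw [Set.disjoint_left]
  intro e he hs
  obtain ⟨y, hy, rfl⟩ := Finset.mem_image.1 (Finset.mem_coe.1 hs)
  obtain ⟨x, hx, h⟩ := Finset.mem_image.1 (Finset.mem_coe.1 he)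
  rw [Sym2.eq_iff] at h
  rcases h with ⟨h, -⟩ | ⟨h, -⟩
  · exact hzw h
  · exact hz (h ▸ hy)

lemma cliqueEvent_eq (X : Finset V) : cliqueEvent X = ⋂ e ∈ pairs X, edgeEvent e := by
  ext G
  simp only [cliqueEvent, edgeEvent, Set.mem_ofPred_eq, Set.mem_iInter]
  constructor
  · intro h e he
    induction e with | _ a b
    simp [pairs] at he
    exact h he.1.1 he.1.2 he.2
  · intro h a ha b hb hab
    have := h s(a, b) (by simp [pairs]; exact ⟨⟨ha, hb⟩, hab⟩)
    simpa using this

lemma uniformEvent_true (z : V) (X : Finset V) :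
    uniformEvent true z X = ⋂ e ∈ star z X, edgeEvent e := by
  ext G
  simp [uniformEvent, star, edgeEvent]

lemma uniformEvent_false (z : V) (X : Finset V) :
    uniformEvent false z X = ⋂ e ∈ star z X, (edgeEvent e)ᶜ := by
  ext G
  simp [uniformEvent, star, edgeEvent]

lemma uniformEvent_union (b : Bool) (z : V) (X Y : Finset V) :
    uniformEvent b z (X ∪ Y) = uniformEvent b z X ∩ uniformEvent b z Y := by
  ext G
  simp only [uniformEvent, Finset.mem_union, Set.mem_ofPred_eq, Set.mem_inter_iff]
  grind

lemma dependsOnEdges_cliqueEvent (X : Finset V) :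
    DependsOnEdges (pairs X : Set (Sym2 V)) (cliqueEvent X) := by
  rw [cliqueEvent_eq]
  exact dependsOnEdges_present _

lemma dependsOnEdges_uniformEvent (b : Bool) (z : V) (X : Finset V) :
    DependsOnEdges (star z X : Set (Sym2 V)) (uniformEvent b z X) := by
  cases b
  · rw [uniformEvent_false]
    exact DependsOnEdges.biInter _ fun _ he => (dependsOnEdges_edgeEvent he).compl
  · rw [uniformEvent_true]
    exact dependsOnEdges_present _

lemma dependsOnEdges_cliqueEvent_inter (X Y : Finset V) :
    DependsOnEdges (pairs (X ∪ Y) : Set (Sym2 V)) (cliqueEvent X ∩ cliqueEvent Y) := by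
  refine ((dependsOnEdges_cliqueEvent X).mono ?_).inter ((dependsOnEdges_cliqueEvent Y).mono ?_)
  · exact_mod_cast Finset.subset_union_left.trans (pairs_union_subset X Y)
  · exact_mod_cast Finset.subset_union_right.trans (pairs_union_subset X Y)

/-- `p` or `1 - p`, the probability that a pair has adjacency status `b`. -/
noncomputable def edgeProb (p : I) (b : Bool) : ℝ := bif b then (p : ℝ) else 1 - p

lemma edgeProb_nonneg (p : I) (b : Bool) : 0 ≤ edgeProb p b := by
  have h0 := p.2.1
  have h1 := p.2.2
  cases b <;> simp [edgeProb, h0, h1]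

lemma edgeProb_le_one (p : I) (b : Bool) : edgeProb p b ≤ 1 := by
  have h0 := p.2.1
  have h1 := p.2.2
  cases b <;> simp [edgeProb, h0, h1]

variable [Fintype V] (p : I)

lemma real_uniformEvent (b : Bool) {z : V} {X : Finset V} (hz : z ∉ X) :
    (SimpleGraph.binomialRandom V p).real (uniformEvent b z X) = edgeProb p b ^ X.card := by
  cases b
  · rw [uniformEvent_false, real_absent p _ fun e he => not_isDiag_of_mem_star hz he, card_star]
    rfl
  · rw [uniformEvent_true, real_present p _ fun e he => not_isDiag_of_mem_star hz he, card_star]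
    rfl

lemma real_cliqueEvent (X : Finset V) :
    (SimpleGraph.binomialRandom V p).real (cliqueEvent X) = (p : ℝ) ^ X.card.choose 2 := by
  rw [cliqueEvent_eq, real_present p _ fun e he => not_isDiag_of_mem_pairs he, card_pairs]

/-- Pairs inside X ∩ Y are required twice but paid for once. The overlap factor stands on the left
to avoid subtraction of exponents and division. -/
lemma real_cliqueEvent_inter (X Y : Finset V) :
    (SimpleGraph.binomialRandom V p).real (cliqueEvent X ∩ cliqueEvent Y) *
      (p : ℝ) ^ (X ∩ Y).card.choose 2 =
      (p : ℝ) ^ X.card.choose 2 * (p : ℝ) ^ Y.card.choose 2 := by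
  have : (cliqueEvent X ∩ cliqueEvent Y) = ⋂ e ∈ pairs X ∪ pairs Y, edgeEvent e := by
    ext G
    simp only [cliqueEvent_eq, Set.mem_inter_iff, Set.mem_iInter, Finset.mem_union]
    grind
  rw [this, real_present, ← pow_add, card_pairs_union, pow_add]
  intro e he
  rcases Finset.mem_union.1 he with h | h <;> exact not_isDiag_of_mem_pairs h

lemma real_compl_uniformEvent (b : Bool) {z : V} {X : Finset V} (hz : z ∉ X) :
    (SimpleGraph.binomialRandom V p).real (uniformEvent b z X)ᶜ = 1 - edgeProb p b ^ X.card := by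
  rw [probReal_compl_eq_one_sub (measurableSet_of_finite_graph _), real_uniformEvent p b hz]

lemma real_compl_uniformEvent_inter (b : Bool) {z : V} {X Y : Finset V} (hz : z ∉ X ∪ Y) :
    (SimpleGraph.binomialRandom V p).real ((uniformEvent b z X)ᶜ ∩ (uniformEvent b z Y)ᶜ) =
      1 - edgeProb p b ^ X.card - edgeProb p b ^ Y.card + edgeProb p b ^ (X ∪ Y).card := by
  have hX : z ∉ X := fun h => hz (Finset.mem_union_left _ h)
  have hY : z ∉ Y := fun h => hz (Finset.mem_union_right _ h)
  rw [← Set.compl_union, probReal_compl_eq_one_sub (measurableSet_of_finite_graph _)]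
  have := measureReal_union_add_inter (μ := SimpleGraph.binomialRandom V p)
    (s := uniformEvent b z X) (t := uniformEvent b z Y) (measurableSet_of_finite_graph _)
  rw [← uniformEvent_union, real_uniformEvent p b hz, real_uniformEvent p b hX,
    real_uniformEvent p b hY] at this
  linarith

/-- The event that `Y` is a clique and every vertex outside `Y` has a neighbour in `X`. -/
def dominatingEvent (X Y : Finset V) : Set (SimpleGraph V) :=
  cliqueEvent Y ∩ ⋂ z ∈ Yᶜ, (uniformEvent false z X)ᶜ

/-- The stars from the vertices outside Y to X are disjoint from one another and from the pairs
inside Y, so the probability is a product. The case X = Y serves φ¹_C, the case of Y one vertex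
larger serves φ³_C. -/
lemma real_dominatingEvent {X Y : Finset V} (hXY : X ⊆ Y) :
    (SimpleGraph.binomialRandom V p).real (dominatingEvent X Y) =
      (p : ℝ) ^ Y.card.choose 2 * (1 - (1 - p : ℝ) ^ X.card) ^ (Fintype.card V - Y.card) := by
  rw [dominatingEvent, real_inter_biInter p Yᶜ (dependsOnEdges_cliqueEvent Y)
    (fun z => (star z X : Set (Sym2 V))) _ (fun z _ => (dependsOnEdges_uniformEvent false z X).compl),
    real_cliqueEvent]
  · congr 1
    rw [← Finset.card_compl, ← Finset.prod_const]
    refine Finset.prod_congr rfl fun z hz => ?_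
    rw [real_compl_uniformEvent]
    · rfl
    · exact fun h => Finset.mem_compl.1 hz (hXY h)
  · exact fun z hz => disjoint_pairs_star (Finset.mem_compl.1 hz)
  · exact fun z hz w hw hzw => disjoint_star_star hzw fun h => Finset.mem_compl.1 hz (hXY h)

/-- Only an upper bound, because the domination of vertices inside Y ∪ Y' is dropped; this makes the
remaining conditions independent. The base of the last power is inclusion–exclusion for a vertex
missing X or X'. -/
lemma real_dominatingEvent_inter_le {X Y X' Y' : Finset V} (hXY : X ⊆ Y) (hXY' : X' ⊆ Y') :
    (SimpleGraph.binomialRandom V p).real (dominatingEvent X Y ∩ dominatingEvent X' Y') *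
      (p : ℝ) ^ (Y ∩ Y').card.choose 2 ≤
      (p : ℝ) ^ Y.card.choose 2 * (p : ℝ) ^ Y'.card.choose 2 *
      (1 - (1 - p : ℝ) ^ X.card - (1 - p : ℝ) ^ X'.card + (1 - p : ℝ) ^ (X ∪ X').card) ^
        (Fintype.card V - (Y ∪ Y').card) := by
  have hsub : dominatingEvent X Y ∩ dominatingEvent X' Y' ⊆
      (cliqueEvent Y ∩ cliqueEvent Y') ∩ ⋂ z ∈ (Y ∪ Y')ᶜ,
        ((uniformEvent false z X)ᶜ ∩ (uniformEvent false z X')ᶜ) := by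
    rintro G ⟨⟨h1, h2⟩, h3, h4⟩
    refine ⟨⟨h1, h3⟩, ?_⟩
    simp only [Set.mem_iInter, Finset.mem_compl, Finset.mem_union, not_or] at h2 h4 ⊢
    exact fun z hz => ⟨h2 z hz.1, h4 z hz.2⟩
  have hzX : ∀ z ∈ (Y ∪ Y')ᶜ, z ∉ X ∪ X' := by
    intro z hz h
    exact Finset.mem_compl.1 hz (Finset.union_subset_union hXY hXY' h)
  have h := measureReal_mono (μ := SimpleGraph.binomialRandom V p) hsub
  rw [real_inter_biInter p _ (dependsOnEdges_cliqueEvent_inter Y Y')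
    (fun z => (star z (X ∪ X') : Set (Sym2 V)))] at h
  · refine (mul_le_mul_of_nonneg_right h (pow_nonneg p.2.1 _)).trans (le_of_eq ?_)
    rw [mul_right_comm, real_cliqueEvent_inter]
    congr 1
    rw [← Finset.card_compl, ← Finset.prod_const]
    refine Finset.prod_congr rfl fun z hz => ?_
    rw [real_compl_uniformEvent_inter p false (hzX z hz)]
    rfl
  · intro z _
    refine ((dependsOnEdges_uniformEvent false z X).compl.mono ?_).inter
      ((dependsOnEdges_uniformEvent false z X').compl.mono ?_)
    · exact_mod_cast Finset.image_subset_image Finset.subset_union_left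
    · exact_mod_cast Finset.image_subset_image Finset.subset_union_right
  · exact fun z hz => disjoint_pairs_star (Finset.mem_compl.1 hz)
  · exact fun z hz w hw hzw => disjoint_star_star hzw (hzX z hz)

/-- The event that `X` is a clique all of whose vertices have adjacency status `b` with `v`. -/
def rootedEvent (b : Bool) (v : V) (X : Finset V) : Set (SimpleGraph V) :=
  cliqueEvent X ∩ uniformEvent b v X

lemma real_rootedEvent (b : Bool) {v : V} {X : Finset V} (hv : v ∉ X) :
    (SimpleGraph.binomialRandom V p).real (rootedEvent b v X) =
      (p : ℝ) ^ X.card.choose 2 * edgeProb p b ^ X.card := by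
  rw [rootedEvent, (dependsOnEdges_cliqueEvent X).real_inter p (disjoint_pairs_star hv)
    (dependsOnEdges_uniformEvent b v X), real_cliqueEvent, real_uniformEvent p b hv]

lemma real_rootedEvent_inter (b : Bool) {v : V} {X Y : Finset V} (hX : v ∉ X) (hY : v ∉ Y) :
    (SimpleGraph.binomialRandom V p).real (rootedEvent b v X ∩ rootedEvent b v Y) *
      ((p : ℝ) ^ (X ∩ Y).card.choose 2 * edgeProb p b ^ (X ∩ Y).card) =
      ((p : ℝ) ^ X.card.choose 2 * edgeProb p b ^ X.card) *
      ((p : ℝ) ^ Y.card.choose 2 * edgeProb p b ^ Y.card) := by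
  have hv : v ∉ X ∪ Y := by simp [hX, hY]
  have : rootedEvent b v X ∩ rootedEvent b v Y =
      (cliqueEvent X ∩ cliqueEvent Y) ∩ uniformEvent b v (X ∪ Y) := by
    rw [rootedEvent, rootedEvent, uniformEvent_union, Set.inter_inter_inter_comm]
  rw [this, (dependsOnEdges_cliqueEvent_inter X Y).real_inter p (disjoint_pairs_star hv)
    (dependsOnEdges_uniformEvent b v (X ∪ Y)), real_uniformEvent p b hv]
  have h1 := real_cliqueEvent_inter p X Y
  have h2 := Finset.card_union_add_card_inter X Y
  calc _ = ((SimpleGraph.binomialRandom V p).real (cliqueEvent X ∩ cliqueEvent Y) *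
      (p : ℝ) ^ (X ∩ Y).card.choose 2) * edgeProb p b ^ ((X ∪ Y).card + (X ∩ Y).card) := by
        rw [pow_add]; ring
    _ = _ := by rw [h1, h2, pow_add]; ring

end Events

/-! ### First moment bounds for violations of φ¹_C and φ³_C. -/

section UnionBounds

lemma prob_not (n : ℕ) (p : I) (Q : SimpleGraph (Fin n) → Prop) :
    prob n p (fun G => ¬ Q G) = 1 - prob n p Q := by
  unfold prob
  rw [← probReal_compl_eq_one_sub (measurableSet_of_finite_graph _)]
  rfl

lemma prob_nonneg (n : ℕ) (p : I) (Q : SimpleGraph (Fin n) → Prop) : 0 ≤ prob n p Q :=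
  measureReal_nonneg

lemma prob_le_one (n : ℕ) (p : I) (Q : SimpleGraph (Fin n) → Prop) : prob n p Q ≤ 1 :=
  measureReal_le_one

lemma prob_mono (n : ℕ) (p : I) {Q R : SimpleGraph (Fin n) → Prop} (h : ∀ G, Q G → R G) :
    prob n p Q ≤ prob n p R :=
  measureReal_mono h

lemma mem_dominatingEvent {n : ℕ} {X Y : Finset (Fin n)} {G : SimpleGraph (Fin n)} :
    G ∈ dominatingEvent X Y ↔ G.IsClique (Y : Set (Fin n)) ∧ ∀ z ∉ Y, ∃ x ∈ X, G.Adj z x := by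
  simp [dominatingEvent, cliqueEvent, uniformEvent]

lemma prob_not_phiC1_le (n : ℕ) (p : I) :
    prob n p (fun G => ¬ PhiC1 G) ≤ ∑ k ∈ Finset.range (n + 1),
      (n.choose k : ℝ) * ((p : ℝ) ^ k.choose 2 * (1 - (1 - p : ℝ) ^ k) ^ (n - k)) := by
  have hsub : {G : SimpleGraph (Fin n) | ¬ PhiC1 G} ⊆
      ⋃ X ∈ (Finset.univ : Finset (Fin n)).powerset, dominatingEvent X X := by
    intro G hG
    simp only [PhiC1, PhiC, Set.mem_ofPred_eq] at hG
    push Not at hG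
    obtain ⟨X, hX, h⟩ := hG
    classical
    refine Set.mem_biUnion (x := X.toFinset) (by simp) (mem_dominatingEvent.2 ⟨by simpa using hX, ?_⟩)
    simpa using h
  refine (measureReal_mono hsub (measure_ne_top _ _)).trans ((measureReal_biUnion_finset_le _ _).trans (le_of_eq ?_))
  simp_rw [real_dominatingEvent p (Finset.Subset.refl _)]
  rw [Finset.sum_powerset_apply_card (fun k => (p : ℝ) ^ k.choose 2 * (1 - (1 - p : ℝ) ^ k) ^
    (Fintype.card (Fin n) - k))]
  simp

lemma exists_dominatingEvent_of_not_phiC3 {n : ℕ} {G : SimpleGraph (Fin n)} (h : ¬ PhiC3 G) :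
    ∃ X : Finset (Fin n), ∃ x ∉ X, G ∈ dominatingEvent X (insert x X) := by
  classical
  simp only [mem_dominatingEvent]
  simp only [PhiC3, PhiC, MaxCl] at h
  push Not at h
  obtain ⟨X, ⟨hX, h1⟩, h2⟩ := h
  obtain ⟨x, hx, h3⟩ := h2 hX
  refine ⟨X.toFinset, x, by simpa using hx, ?_, ?_⟩
  · rw [Finset.coe_insert, SimpleGraph.isClique_insert]
    exact ⟨by simpa using hX, fun b hb _ => h3 b (by simpa using hb)⟩
  · intro z hz
    obtain ⟨y, hy, hzy⟩ := h1 z (by simp at hz; exact hz.2)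
    exact ⟨y, by simpa using hy, hzy⟩

/-- X must be nonempty so that x, adjacent to all of X, is not itself a vertex missing X. -/
lemma not_phiC3_of_mem_dominatingEvent {n : ℕ} {G : SimpleGraph (Fin n)} {X : Finset (Fin n)}
    (hX : X.Nonempty) {x : Fin n} (hx : x ∉ X) (hG : G ∈ dominatingEvent X (insert x X)) :
    ¬ PhiC3 G := by
  obtain ⟨hc, hd⟩ := mem_dominatingEvent.1 hG
  intro h
  rw [Finset.coe_insert, SimpleGraph.isClique_insert] at hc
  have hne : ∀ y ∈ X, x ≠ y := fun y hy e => hx (e ▸ hy)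
  refine (h X ⟨hc.1, ?_⟩).2 ⟨x, by simpa using hx, fun y hy => hc.2 y hy (hne y hy)⟩
  rintro ⟨z, hz, hzX⟩
  by_cases hzx : z = x
  · obtain ⟨y, hy⟩ := hX
    exact hzX y hy (hzx ▸ hc.2 y hy (hne y hy))
  · obtain ⟨y, hy, hzy⟩ := hd z (by simpa [hzx] using hz)
    exact hzX y hy hzy

lemma prob_not_phiC3_le (n : ℕ) (p : I) :
    prob n p (fun G => ¬ PhiC3 G) ≤ ∑ k ∈ Finset.range (n + 1),
      (n.choose k : ℝ) * ((n - k : ℕ) *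
        ((p : ℝ) ^ (k + 1).choose 2 * (1 - (1 - p : ℝ) ^ k) ^ (n - (k + 1)))) := by
  have hsub : {G : SimpleGraph (Fin n) | ¬ PhiC3 G} ⊆
      ⋃ X ∈ (Finset.univ : Finset (Fin n)).powerset, ⋃ x ∈ Xᶜ, dominatingEvent X (insert x X) := by
    intro G hG
    obtain ⟨X, x, hx, h⟩ := exists_dominatingEvent_of_not_phiC3 hG
    exact Set.mem_biUnion (x := X) (by simp) (Set.mem_biUnion (x := x) (by simpa using hx) h)
  refine (measureReal_mono hsub (measure_ne_top _ _)).trans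
    ((measureReal_biUnion_finset_le _ _).trans ?_)
  have hX : ∀ X ∈ (Finset.univ : Finset (Fin n)).powerset,
      (SimpleGraph.binomialRandom (Fin n) p).real (⋃ x ∈ Xᶜ, dominatingEvent X (insert x X)) ≤
      (n - X.card : ℕ) * ((p : ℝ) ^ (X.card + 1).choose 2 *
        (1 - (1 - p : ℝ) ^ X.card) ^ (n - (X.card + 1))) := by
    intro X _
    refine (measureReal_biUnion_finset_le _ _).trans (le_of_eq ?_)
    rw [Finset.sum_congr rfl fun x hx => real_dominatingEvent p (Finset.subset_insert x X),
      Finset.sum_congr rfl fun x hx => by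
        rw [Finset.card_insert_of_notMem (Finset.mem_compl.1 hx)]]
    rw [Finset.sum_const, Finset.card_compl, Fintype.card_fin, nsmul_eq_mul]
  refine (Finset.sum_le_sum hX).trans (le_of_eq ?_)
  rw [Finset.sum_powerset_apply_card (fun k => ((n - k : ℕ) : ℝ) * ((p : ℝ) ^ (k + 1).choose 2 *
    (1 - (1 - p : ℝ) ^ k) ^ (n - (k + 1))))]
  simp

end UnionBounds

/-! ### Dominated convergence for sums and exponential estimates. -/

section Estimates

/-- A sum of `n + 1` terms dominated by a summable sequence tends to zero if each term does. -/
lemma tendsto_sum_range_of_dominated {f : ℕ → ℕ → ℝ} {bound : ℕ → ℝ} (hb : Summable bound)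
    {N : ℕ → ℕ} (hf : ∀ᶠ m in atTop, ∀ k ≤ N m, |f m k| ≤ bound k)
    (hlim : ∀ k, Tendsto (fun m => f m k) atTop (𝓝 0)) (hb0 : ∀ k, 0 ≤ bound k) :
    Tendsto (fun m => ∑ k ∈ Finset.range (N m + 1), f m k) atTop (𝓝 0) := by
  have h := tendsto_tsum_of_dominated_convergence (𝓕 := atTop) (β := ℕ)
    (f := fun m k => if k ≤ N m then f m k else 0) (g := fun _ => 0) hb ?_ ?_
  · rw [tsum_zero] at h
    refine h.congr fun m => ?_
    rw [tsum_eq_sum (s := Finset.range (N m + 1))]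
    · exact Finset.sum_congr rfl fun k hk => if_pos (by simp at hk; omega)
    · intro k hk
      exact if_neg (by simp at hk; omega)
  · intro k
    refine squeeze_zero_norm (a := fun m => |f m k|) (fun m => ?_) (by simpa using (hlim k).abs)
    by_cases h : k ≤ N m <;> simp [h]
  · filter_upwards [hf] with m hm k
    by_cases h : k ≤ N m
    · simpa [h] using hm k h
    · simpa [h] using hb0 k

lemma choose_le_pow_div (n k : ℕ) : (n.choose k : ℝ) ≤ (n : ℝ) ^ k / k.factorial :=
  Nat.choose_le_pow_div k n

/-- Bernoulli's inequality applied to (1/q)^k. -/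
lemma nat_mul_pow_le {q : ℝ} (h0 : 0 < q) (h1 : q < 1) (k : ℕ) : k * q ^ k ≤ 1 / (1 - q) := by
  have hb := one_add_mul_le_pow (a := 1 / q - 1) (by
    have : 0 < 1 / q := by positivity
    linarith) k
  have e : (1 + (1 / q - 1)) ^ k * q ^ k = 1 := by
    rw [← mul_pow]; field_simp; simp
  have hk : (0 : ℝ) ≤ k := Nat.cast_nonneg k
  have hqk : 0 < q ^ k := by positivity
  have h2 : (k * (1 / q - 1)) * q ^ k ≤ 1 := by
    refine le_trans ?_ e.le
    gcongr
    linarith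
  rw [le_div_iff₀ (by linarith)]
  have h3 : k * q ^ k * (1 - q) = (k * (1 / q - 1)) * q ^ k * q := by field_simp
  rw [h3]
  nlinarith

/-- Omitting j factors costs at most exp(j q^k), and (k + 1) q^k is bounded uniformly in k. -/
lemma one_sub_pow_pow_le {q : ℝ} (h0 : 0 < q) (h1 : q < 1) {n k j : ℕ} (hj : j ≤ n) (hk : j ≤ k + 1) :
    (1 - q ^ k) ^ (n - j) ≤ Real.exp (1 + 1 / (1 - q)) * Real.exp (-(n * q ^ k)) := by
  have hq : q ^ k ≤ 1 := pow_le_one₀ h0.le h1.le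
  have hq0 : 0 < q ^ k := by positivity
  have h2 : 1 - q ^ k ≤ Real.exp (-(q ^ k)) := by
    have := Real.add_one_le_exp (-(q ^ k)); linarith
  refine (pow_le_pow_left₀ (by linarith) h2 _).trans ?_
  rw [← Real.exp_nat_mul, ← Real.exp_add, Real.exp_le_exp, Nat.cast_sub hj]
  have h3 := nat_mul_pow_le h0 h1 k
  have h4 : (j : ℝ) * q ^ k ≤ (k + 1) * q ^ k := by gcongr; exact_mod_cast hk
  nlinarith

lemma two_mul_choose_two_add (k : ℕ) : 2 * k.choose 2 + k = k ^ 2 := by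
  induction k with
  | zero => simp
  | succ k ih =>
    rw [Nat.choose_succ_succ' k 1, Nat.choose_one_right]
    nlinarith

lemma tendsto_pow_mul_exp_neg_mul {N : ℕ → ℕ} (hN : Tendsto N atTop atTop) {q : ℝ} (h0 : 0 < q)
    (k j : ℕ) : Tendsto (fun m => ((N m : ℝ) * q ^ k) ^ j * Real.exp (-(N m * q ^ k))) atTop (𝓝 0) :=
  (Real.tendsto_pow_mul_exp_neg_atTop_nhds_zero j).comp
    ((tendsto_natCast_atTop_atTop.comp hN).atTop_mul_const (by positivity))

lemma pow_mul_exp_neg_le_factorial {y : ℝ} (hy : 0 ≤ y) (k : ℕ) :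
    y ^ k / k.factorial * Real.exp (-y) ≤ 1 := by
  rw [Real.exp_neg, mul_inv_le_iff₀ (Real.exp_pos y), one_mul]
  exact Real.pow_div_factorial_le_exp y hy k

lemma pow_div_factorial_le_exp_mul {y θ : ℝ} (hy : 0 ≤ y) (hθ : 0 < θ) (k : ℕ) :
    y ^ k / k.factorial ≤ Real.exp (θ * y) * (1 / θ) ^ k := by
  have h := Real.pow_div_factorial_le_exp (θ * y) (by positivity) k
  have : y ^ k / k.factorial = (θ * y) ^ k / k.factorial * (1 / θ) ^ k := by
    rw [mul_pow, one_div, inv_pow]; field_simp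
  rw [this]
  gcongr

end Estimates

/-! ### The case p < q²: the first moment tends to zero. -/

section Subcritical

lemma tendsto_prob_phiC1 (p : I) (hp0 : 0 < (p : ℝ)) (hp1 : (p : ℝ) < 1)
    (hp : (p : ℝ) < (1 - p) ^ 2) : Tendsto (fun n => prob n p fun G => PhiC1 G) atTop (𝓝 1) := by
  set q : ℝ := 1 - p with hq
  have hq0 : 0 < q := by linarith
  have hq1 : q < 1 := by linarith
  set s : ℝ := p / q ^ 2 with hs
  have hs0 : 0 < s := by positivity
  have hs1 : s < 1 := by rw [hs, div_lt_one (by positivity)]; exact hp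
  set C : ℝ := Real.exp (1 + 1 / (1 - q)) with hC
  have hC0 : 0 < C := Real.exp_pos _
  -- Rewriting n^k as y^k q^(-k²) and using k² = 2 (k choose 2) + k isolates the decisive ratio s =
  -- p/q².
  have hpow : ∀ k : ℕ, (p : ℝ) ^ k.choose 2 * ((q ^ k) ^ k)⁻¹ = s ^ k.choose 2 * (1 / q) ^ k := by
    intro k
    have : (q ^ k) ^ k = (q ^ 2) ^ k.choose 2 * q ^ k := by
      rw [← pow_mul, ← pow_mul, ← pow_add, two_mul_choose_two_add, sq]
    rw [this, hs, div_pow, one_div, inv_pow]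
    field_simp
  have hterm : ∀ n k : ℕ, k ≤ n →
      (n.choose k : ℝ) * ((p : ℝ) ^ k.choose 2 * (1 - q ^ k) ^ (n - k)) ≤
      (C * (s ^ k.choose 2 * (1 / q) ^ k)) *
        ((n * q ^ k) ^ k / k.factorial * Real.exp (-(n * q ^ k))) := by
    intro n k hk
    have hqk : q ^ k ≤ 1 := pow_le_one₀ hq0.le hq1.le
    calc _ ≤ ((n : ℝ) ^ k / k.factorial) * ((p : ℝ) ^ k.choose 2 * (C * Real.exp (-(n * q ^ k)))) := by
          gcongr
          · exact choose_le_pow_div n k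
          · exact one_sub_pow_pow_le hq0 hq1 hk (by omega)
      _ = _ := by
        rw [← hpow, mul_pow]
        field_simp
  have hmain : Tendsto (fun n : ℕ => ∑ k ∈ Finset.range (n + 1),
      (n.choose k : ℝ) * ((p : ℝ) ^ k.choose 2 * (1 - q ^ k) ^ (n - k))) atTop (𝓝 0) := by
    have hnn : ∀ n k : ℕ, 0 ≤ (n.choose k : ℝ) * ((p : ℝ) ^ k.choose 2 * (1 - q ^ k) ^ (n - k)) := by
      intro n k
      have : 0 ≤ 1 - q ^ k := by linarith [pow_le_one₀ (n := k) hq0.le hq1.le]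
      positivity
    refine tendsto_sum_range_of_dominated (bound := fun k => C * (s ^ k.choose 2 * (1 / q) ^ k))
      (N := fun n => n) ?_ (.of_forall fun n k hk => ?_) (fun k => ?_) (fun k => by positivity)
    · refine Summable.mul_left _ ?_
      refine summable_of_ratio_test_tendsto_lt_one (l := 0) one_pos
        (.of_forall fun k => by positivity) ?_
      -- Consecutive bounds have ratio s^k / q, which tends to 0: the quadratic exponent of s beats
      -- the linear one of 1/q.
      have : ∀ k : ℕ, s ^ k * (1 / q) = ‖s ^ (k + 1).choose 2 * (1 / q) ^ (k + 1)‖ /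
          ‖s ^ k.choose 2 * (1 / q) ^ k‖ := by
        intro k
        rw [Real.norm_of_nonneg (by positivity), Real.norm_of_nonneg (by positivity),
          Nat.choose_succ_succ' k 1, Nat.choose_one_right, pow_add, pow_succ]
        field_simp
      refine Tendsto.congr this ?_
      simpa using (tendsto_pow_atTop_nhds_zero_of_lt_one hs0.le hs1).mul_const (1 / q)
    · rw [abs_of_nonneg (hnn n k)]
      refine (hterm n k hk).trans ?_
      refine mul_le_of_le_one_right (by positivity) (pow_mul_exp_neg_le_factorial (by positivity) k)
    · have h := (tendsto_pow_mul_exp_neg_mul tendsto_id hq0 k k).const_mul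
        (C * (s ^ k.choose 2 * (1 / q) ^ k) / k.factorial)
      rw [mul_zero] at h
      refine squeeze_zero' (.of_forall fun n => hnn n k) ?_ h
      filter_upwards [eventually_ge_atTop k] with n hn
      refine (hterm n k hn).trans (le_of_eq ?_)
      simp only [id]
      ring
  have h2 : Tendsto (fun n => prob n p fun G => ¬ PhiC1 G) atTop (𝓝 0) :=
    squeeze_zero (fun n => prob_nonneg _ _ _) (fun n => prob_not_phiC1_le n p) hmain
  have h3 := h2.const_sub 1
  simp only [prob_not, sub_sub_cancel, sub_zero] at h3
  exact h3

end Subcritical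

/-! ### The case p = q², along orders where violations of φ³_C disappear. -/

section CriticalUpper

lemma mul_exp_neg_le {c y : ℝ} (hc : 0 < c) : y * Real.exp (-(c * y)) ≤ 1 / c := by
  have h := Real.add_one_le_exp (c * y)
  rw [Real.exp_neg, mul_inv_le_iff₀ (Real.exp_pos _), one_div, ← div_eq_inv_mul, le_div_iff₀ hc]
  nlinarith

lemma one_sub_add_mul_log_pos {u : ℝ} (h0 : 0 < u) (h1 : u < 1) : 0 < 1 - u + u * Real.log u := by
  have h := Real.log_lt_sub_one_of_pos (x := u⁻¹) (by positivity)
    (fun h => h1.ne (by simpa using h))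
  rw [Real.log_inv] at h
  have h2 : u * (u⁻¹ - 1) = 1 - u := by field_simp
  nlinarith

/-- The Chernoff bound for the lower tail of a Poisson variable of mean y, from (u y)^k/k! ≤ e^(u
y); 1 - u + u log u is its rate. -/
lemma pow_succ_div_factorial_le_of_le_mul {u y : ℝ} (h0 : 0 < u) (h1 : u < 1) (hy : 0 ≤ y) {k : ℕ}
    (hk : k ≤ u * y) : y ^ (k + 1) / k.factorial * Real.exp (-y) ≤
      y * Real.exp (-((1 - u + u * Real.log u) * y)) := by
  have h := pow_div_factorial_le_exp_mul hy h0 k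
  have h2 : (1 / u) ^ k ≤ Real.exp (u * y * (-Real.log u)) := by
    rw [← Real.rpow_natCast, Real.rpow_def_of_pos (by positivity), Real.exp_le_exp, one_div,
      Real.log_inv, mul_comm]
    have : 0 < - Real.log u := by have := Real.log_neg h0 h1; linarith
    gcongr
  calc y ^ (k + 1) / k.factorial * Real.exp (-y)
      = y * (y ^ k / k.factorial) * Real.exp (-y) := by rw [pow_succ]; ring
    _ ≤ y * (Real.exp (u * y) * Real.exp (u * y * (-Real.log u))) * Real.exp (-y) := by
      gcongr; exact h.trans (by gcongr)
    _ = _ := by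
      rw [mul_assoc, ← Real.exp_add, ← Real.exp_add]
      ring_nf

lemma mul_exp_one_sub_lt_one {u : ℝ} (h0 : 0 < u) (h1 : u < 1) : u * Real.exp (1 - u) < 1 := by
  have h : Real.log u < u - 1 := Real.log_lt_sub_one_of_pos h0 h1.ne
  calc u * Real.exp (1 - u) = Real.exp (Real.log u) * Real.exp (1 - u) := by rw [Real.exp_log h0]
    _ = Real.exp (Real.log u + (1 - u)) := (Real.exp_add _ _).symm
    _ < 1 := by rw [Real.exp_lt_one_iff]; linarith

/-- The matching upper tail, with parameter 1/u. -/
lemma pow_succ_div_factorial_le_of_le {u y : ℝ} (h0 : 0 < u) (h1 : u < 1) (hy : 0 ≤ y) {k : ℕ}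
    (hk : y ≤ u * k) : y ^ (k + 1) / k.factorial * Real.exp (-y) ≤
      k * (u * Real.exp (1 - u)) ^ k := by
  have h := pow_div_factorial_le_exp_mul hy (inv_pos.2 h0) k
  rw [one_div, inv_inv] at h
  have hyk : y ≤ k := hk.trans (mul_le_of_le_one_left (by positivity) h1.le)
  calc y ^ (k + 1) / k.factorial * Real.exp (-y)
      = y * (y ^ k / k.factorial) * Real.exp (-y) := by rw [pow_succ]; ring
    _ ≤ k * (Real.exp (u⁻¹ * y) * u ^ k) * Real.exp (-y) := by gcongr
    _ = k * (u ^ k * Real.exp ((u⁻¹ - 1) * y)) := by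
      rw [mul_comm (Real.exp _) (u ^ k), mul_assoc, mul_assoc (u ^ k), ← Real.exp_add]
      ring_nf
    _ ≤ k * (u ^ k * Real.exp ((1 - u) * k)) := by
      have : (u⁻¹ - 1) * y ≤ (1 - u) * k := by
        have h3 : (u⁻¹ - 1) * y ≤ (u⁻¹ - 1) * (u * k) := by
          gcongr
          have := (one_lt_inv₀ h0).2 h1; linarith
        refine h3.trans (le_of_eq ?_)
        field_simp
      gcongr
    _ = _ := by
      rw [mul_pow, ← Real.exp_nat_mul]
      ring_nf

/-- Orders along which every expected count at the critical density is small. -/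
noncomputable def sparseOrder (q : ℝ) (m : ℕ) : ℕ := ⌈m / (√q * q ^ m)⌉₊

lemma sparseOrder_ge {q : ℝ} (h0 : 0 < q) (h1 : q < 1) (m : ℕ) : m ≤ sparseOrder q m := by
  have h : (m : ℝ) ≤ m / (√q * q ^ m) := by
    rw [le_div_iff₀ (by positivity)]
    have : √q * q ^ m ≤ 1 := mul_le_one₀ (Real.sqrt_le_one.2 h1.le) (by positivity)
      (pow_le_one₀ h0.le h1.le)
    exact mul_le_of_le_one_right (by positivity) this
  exact_mod_cast h.trans (Nat.le_ceil _)

lemma tendsto_sparseOrder {q : ℝ} (h0 : 0 < q) (h1 : q < 1) :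
    Tendsto (sparseOrder q) atTop atTop :=
  tendsto_atTop_mono (sparseOrder_ge h0 h1) tendsto_id

lemma le_sqrt_mul_sparseOrder {q : ℝ} (h0 : 0 < q) (h1 : q < 1) {m k : ℕ} (hk : k ≤ m) :
    (k : ℝ) ≤ √q * (sparseOrder q m * q ^ k) := by
  have h : (m : ℝ) / (√q * q ^ m) ≤ sparseOrder q m := Nat.le_ceil _
  rw [div_le_iff₀ (by positivity)] at h
  calc (k : ℝ) ≤ m := by exact_mod_cast hk
    _ ≤ _ := h
    _ = √q * (sparseOrder q m * q ^ m) := by ring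
    _ ≤ _ := by
      gcongr ?_ * (?_ * ?_)
      exact pow_le_pow_of_le_one h0.le h1.le hk

/-- Apart from rounding, y is m/√q at k = m and √q m at k = m + 1, so y/k jumps over 1 with a margin
√q on either side. The ceiling adds at most q^k, absorbed by the gap between m and k. -/
lemma sparseOrder_mul_le {q : ℝ} (h0 : 0 < q) (h1 : q < 1) {m k : ℕ} (hk : m < k) :
    sparseOrder q m * q ^ k ≤ √q * k := by
  have hu : 0 < √q := Real.sqrt_pos.2 h0
  have hu1 : √q ≤ 1 := Real.sqrt_le_one.2 h1.le
  have huu : √q * √q = q := Real.mul_self_sqrt h0.le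
  have h : (sparseOrder q m : ℝ) < m / (√q * q ^ m) + 1 := Nat.ceil_lt_add_one (by positivity)
  obtain ⟨j, rfl⟩ : ∃ j, k = m + 1 + j := ⟨k - (m + 1), by omega⟩
  have hj : q ^ j ≤ 1 := pow_le_one₀ h0.le h1.le
  have hm : q ^ m ≤ 1 := pow_le_one₀ h0.le h1.le
  calc (sparseOrder q m : ℝ) * q ^ (m + 1 + j) ≤ (m / (√q * q ^ m) + 1) * q ^ (m + 1 + j) := by
        gcongr
    _ = √q * m * q ^ j + √q * (√q * q ^ m * q ^ j) := by
      rw [pow_add, pow_add, pow_one]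
      field_simp
      rw [sq, huu]
    _ ≤ √q * m * 1 + √q * (1 * 1 * 1) := by gcongr
    _ = √q * ((m + 1 : ℕ) : ℝ) := by push_cast; ring
    _ ≤ √q * ((m + 1 + j : ℕ) : ℝ) :=
      mul_le_mul_of_nonneg_left (by exact_mod_cast (by omega : m + 1 ≤ m + 1 + j)) hu.le

lemma expected_le {q : ℝ} (h0 : 0 < q) (h1 : q < 1) (n k : ℕ) (hk : k ≤ n) :
    (n.choose k : ℝ) * ((n - k : ℕ) *
        ((q ^ 2) ^ (k + 1).choose 2 * (1 - q ^ k) ^ (n - (k + 1)))) ≤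
      Real.exp (1 + 1 / (1 - q)) *
        ((n * q ^ k) ^ (k + 1) / k.factorial * Real.exp (-(n * q ^ k))) := by
  rcases hk.eq_or_lt with rfl | hlt
  -- For k = n no vertex is left to extend the clique and the term is zero; otherwise k + 1 ≤ n, as
  -- the bound on the domination factor requires.
  · simp; positivity
  have hqk : q ^ k ≤ 1 := pow_le_one₀ h0.le h1.le
  have e : (q ^ 2) ^ (k + 1).choose 2 = (q ^ k) ^ (k + 1) := by
    rw [← pow_mul, ← pow_mul]
    congr 1
    have := two_mul_choose_two_add (k + 1)
    nlinarith
  have h3 : ((n - k : ℕ) : ℝ) ≤ n := by exact_mod_cast Nat.sub_le n k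
  rw [e]
  calc _ ≤ ((n : ℝ) ^ k / k.factorial) * (n * ((q ^ k) ^ (k + 1) *
        (Real.exp (1 + 1 / (1 - q)) * Real.exp (-(n * q ^ k))))) := by
        gcongr
        · exact choose_le_pow_div n k
        · exact one_sub_pow_pow_le h0 h1 hlt le_rfl
    _ = _ := by rw [mul_pow]; ring

lemma tendsto_prob_phiC3_sparseOrder (p : I) (hp0 : 0 < (p : ℝ)) (hp1 : (p : ℝ) < 1)
    (hp : (p : ℝ) = (1 - p) ^ 2) :
    Tendsto (fun m => prob (sparseOrder (1 - p) m) p fun G => PhiC3 G) atTop (𝓝 1) := by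
  set q : ℝ := 1 - p with hq
  have hq0 : 0 < q := by linarith
  have hq1 : q < 1 := by linarith
  have hu0 : 0 < √q := Real.sqrt_pos.2 hq0
  have hu1 : √q < 1 := by rw [Real.sqrt_lt' one_pos]; simpa using hq1
  set C : ℝ := Real.exp (1 + 1 / (1 - q)) with hC
  have hC0 : 0 < C := Real.exp_pos _
  set c : ℝ := 1 - √q + √q * Real.log √q with hc
  have hc0 : 0 < c := one_sub_add_mul_log_pos hu0 hu1
  set ρ : ℝ := √q * Real.exp (1 - √q) with hρ
  have hρ0 : 0 < ρ := by positivity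
  have hρ1 : ρ < 1 := mul_exp_one_sub_lt_one hu0 hu1
  set g : ℕ → ℕ → ℝ := fun m k => (sparseOrder q m * q ^ k) ^ (k + 1) / k.factorial *
    Real.exp (-(sparseOrder q m * q ^ k)) with hg
  have hg0 : ∀ m k, 0 ≤ g m k := fun m k => by positivity
  -- The lower tail handles k ≤ m and the upper tail k > m. In the first case half of the exponent
  -- absorbs the factor y, and the other half gives geometric decay because k ≤ y.
  have hgb : ∀ m k, g m k ≤ 2 / c * Real.exp (-(c / 2)) ^ k + k * ρ ^ k := by
    intro m k
    have hy : 0 ≤ sparseOrder q m * q ^ k := by positivity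
    rcases le_or_gt k m with h | h
    · have h1 := le_sqrt_mul_sparseOrder hq0 hq1 h
      have h3 : (k : ℝ) ≤ sparseOrder q m * q ^ k :=
        h1.trans (mul_le_of_le_one_left hy hu1.le)
      refine (pow_succ_div_factorial_le_of_le_mul hu0 hu1 hy h1).trans ?_
      generalize (sparseOrder q m : ℝ) * q ^ k = y at hy h1 h3
      have h2 := mul_exp_neg_le (y := y) (half_pos hc0)
      calc y * Real.exp (-(c * y)) = (y * Real.exp (-(c / 2 * y))) * Real.exp (-(c / 2 * y)) := by
            rw [mul_assoc, ← Real.exp_add]; ring_nf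
        _ ≤ 1 / (c / 2) * Real.exp (-(c / 2 * k)) := by gcongr
        _ = 2 / c * Real.exp (-(c / 2)) ^ k := by
          rw [← Real.exp_nat_mul]; field_simp
        _ ≤ _ := le_add_of_nonneg_right (by positivity)
    · exact (pow_succ_div_factorial_le_of_le hu0 hu1 hy (sparseOrder_mul_le hq0 hq1 h)).trans
        (le_add_of_nonneg_left (by positivity))
  have hmain : Tendsto (fun m => ∑ k ∈ Finset.range (sparseOrder q m + 1), g m k) atTop (𝓝 0) := by
    refine tendsto_sum_range_of_dominated
      (bound := fun k => 2 / c * Real.exp (-(c / 2)) ^ k + k * ρ ^ k) ?_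
      (.of_forall fun m k _ => by rw [abs_of_nonneg (hg0 m k)]; exact hgb m k) (fun k => ?_)
      (fun k => by positivity)
    · refine ((summable_geometric_of_lt_one (Real.exp_pos _).le ?_).mul_left _).add ?_
      · rw [Real.exp_lt_one_iff]; linarith
      · have := summable_pow_mul_geometric_of_norm_lt_one 1 (r := ρ)
          (by rwa [Real.norm_of_nonneg hρ0.le])
        simpa using this
    · have h := (tendsto_pow_mul_exp_neg_mul (tendsto_sparseOrder hq0 hq1) hq0 k (k + 1)).const_mul
        (1 / k.factorial : ℝ)
      rw [mul_zero] at h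
      refine h.congr fun m => ?_
      simp only [hg]
      ring
  have h2 : Tendsto (fun m => prob (sparseOrder q m) p fun G => ¬ PhiC3 G) atTop (𝓝 0) := by
    have h := hmain.const_mul C
    rw [mul_zero] at h
    refine squeeze_zero (fun n => prob_nonneg _ _ _) (fun m => ?_) h
    refine (prob_not_phiC3_le _ p).trans ?_
    rw [Finset.mul_sum]
    refine Finset.sum_le_sum fun k hk => ?_
    have := expected_le hq0 hq1 (sparseOrder q m) k (by simp at hk; omega)
    rw [← hq]
    rwa [← hp] at this
  have h3 := h2.const_sub 1
  simp only [prob_not, sub_sub_cancel, sub_zero] at h3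
  exact h3

end CriticalUpper

/-! ### Counting k-sets by their overlap with a given set. -/

section Counting

variable {V : Type*} [DecidableEq V]

/-- Y is determined by X ∩ Y and Y \ X. -/
lemma card_filter_card_inter_le {S X : Finset V} (hX : X ⊆ S) (k l : ℕ) :
    ((S.powersetCard k).filter fun Y => (X ∩ Y).card = l).card ≤
      X.card.choose l * (S.card - X.card).choose (k - l) := by
  rw [← Finset.card_sdiff_of_subset hX, ← Finset.card_powersetCard, ← Finset.card_powersetCard,
    ← Finset.card_product]
  refine Finset.card_le_card_of_injOn (fun Y => (X ∩ Y, Y \ X)) ?_ ?_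
  · intro Y hY
    simp only [Finset.coe_filter, Finset.mem_powersetCard, Set.mem_ofPred_eq] at hY
    obtain ⟨⟨h1, h2⟩, h3⟩ := hY
    simp only [Finset.coe_product, Set.mem_prod, Finset.mem_coe, Finset.mem_powersetCard]
    refine ⟨⟨Finset.inter_subset_left, h3⟩, Finset.sdiff_subset_sdiff h1 le_rfl, ?_⟩
    rw [Finset.card_sdiff, h2, h3]
  · intro Y _ Z _ h
    simp only [Prod.mk.injEq] at h
    rw [← Finset.sdiff_union_inter Y X, ← Finset.sdiff_union_inter Z X, h.2,
      Finset.inter_comm Y, h.1, Finset.inter_comm X]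

lemma sum_card_inter_le {S X : Finset V} (hX : X ⊆ S) (k : ℕ) {f : ℕ → ℝ} (hf : ∀ l, 0 ≤ f l) :
    ∑ Y ∈ S.powersetCard k, f (X ∩ Y).card ≤ ∑ l ∈ Finset.range (k + 1),
      (X.card.choose l * (S.card - X.card).choose (k - l) : ℕ) * f l := by
  have hmap : ∀ Y ∈ S.powersetCard k, (X ∩ Y).card ∈ Finset.range (k + 1) := by
    intro Y hY
    rw [Finset.mem_range, Nat.lt_succ_iff, ← (Finset.mem_powersetCard.1 hY).2]
    exact Finset.card_le_card Finset.inter_subset_right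
  rw [← Finset.sum_fiberwise_of_maps_to hmap]
  refine Finset.sum_le_sum fun l _ => ?_
  rw [Finset.sum_congr rfl (g := fun _ => f l) (fun Y hY => by rw [(Finset.mem_filter.1 hY).2]),
    Finset.sum_const, nsmul_eq_mul]
  refine mul_le_mul_of_nonneg_right ?_ (hf l)
  exact_mod_cast card_filter_card_inter_le hX k l

/-- Induction on l through C(m,j) (m - j) = C(m,j+1) (j + 1): each lowering of the lower index costs
a factor at most k/(m - k). -/
lemma choose_sub_mul_pow_le {m k l : ℕ} (hl : l ≤ k) :
    m.choose (k - l) * (m - k) ^ l ≤ m.choose k * k ^ l := by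
  induction l with
  | zero => simp
  | succ l ih =>
    obtain ⟨j, rfl⟩ : ∃ j, k = j + 1 + l := ⟨k - (l + 1), by omega⟩
    have ih := ih (by omega)
    have e1 : j + 1 + l - l = j + 1 := by omega
    have e2 : j + 1 + l - (l + 1) = j := by omega
    rw [e1] at ih
    rw [e2]
    have h := Nat.choose_succ_right_eq m j
    calc m.choose j * (m - (j + 1 + l)) ^ (l + 1)
        ≤ m.choose j * ((m - j) * (m - (j + 1 + l)) ^ l) := by
          rw [pow_succ']; gcongr; omega
      _ = (m.choose (j + 1) * (m - (j + 1 + l)) ^ l) * (j + 1) := by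
          rw [← mul_assoc, ← h]; ring
      _ ≤ (m.choose (j + 1 + l) * (j + 1 + l) ^ l) * (j + 1 + l) :=
          Nat.mul_le_mul ih (by omega)
      _ = _ := by ring

lemma choose_mul_choose_le {m k l : ℕ} (hl : l ≤ k) (hk : k < m) :
    ((k.choose l * (m - k).choose (k - l) : ℕ) : ℝ) ≤
      m.choose k * ((k : ℝ) ^ 2 / (m - k)) ^ l := by
  have hmk : (0 : ℝ) < m - k := by
    have : (k : ℝ) < m := by exact_mod_cast hk
    linarith
  have h := choose_sub_mul_pow_le (m := m) hl
  have h' : (m.choose (k - l) : ℝ) * ((m : ℝ) - k) ^ l ≤ m.choose k * (k : ℝ) ^ l := by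
    rw [← Nat.cast_sub hk.le]; exact_mod_cast h
  have h1 : (m - k).choose (k - l) ≤ m.choose (k - l) := Nat.choose_le_choose _ (Nat.sub_le m k)
  have h2 : k.choose l ≤ k ^ l := Nat.choose_le_pow k l
  calc ((k.choose l * (m - k).choose (k - l) : ℕ) : ℝ) ≤ (k : ℝ) ^ l * m.choose (k - l) := by
        exact_mod_cast Nat.mul_le_mul h2 h1
    _ ≤ (k : ℝ) ^ l * (m.choose k * (k : ℝ) ^ l / ((m : ℝ) - k) ^ l) := by
        gcongr; rwa [le_div_iff₀ (by positivity)]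
    _ = _ := by rw [div_pow]; ring

end Counting

/-! ### Second moment for cliques with prescribed adjacency to a root. -/

section Rooted

lemma sqrt_pow_pow_le_pow_choose_two {p : ℝ} (h0 : 0 < p) (h1 : p ≤ 1) {k l : ℕ} (hl : l ≤ k) :
    (√p ^ k) ^ l ≤ p ^ l.choose 2 := by
  have hs : √p ≤ 1 := Real.sqrt_le_one.2 h1
  have h : p ^ l.choose 2 = √p ^ (2 * l.choose 2) := by rw [pow_mul, Real.sq_sqrt h0.le]
  rw [h, ← pow_mul]
  refine pow_le_pow_of_le_one (Real.sqrt_nonneg _) hs ?_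
  have := two_mul_choose_two_add l
  nlinarith

lemma geom_sum_le_inv {β : ℝ} (h0 : 0 ≤ β) (h1 : β < 1) (k : ℕ) :
    ∑ l ∈ Finset.range k, β ^ l ≤ (1 - β)⁻¹ := by
  rw [← tsum_geometric_of_lt_one h0 h1]
  exact (summable_geometric_of_lt_one h0 h1).sum_le_tsum _ fun _ _ => by positivity

/-- `X` is a `k`-clique avoiding `v` all of whose vertices have adjacency status `b` with `v`, and no
other vertex has the opposite status with all of `X`. -/
def HasRootedClique {V : Type*} (b : Bool) (v : V) (k : ℕ) (G : SimpleGraph V) : Prop :=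
  ∃ X : Finset V, X.card = k ∧ v ∉ X ∧ G.IsClique (X : Set V) ∧ (∀ x ∈ X, (G.Adj v x ↔ b = true)) ∧
    ∀ z, z ∉ X → z ≠ v → ¬ ∀ x ∈ X, (G.Adj z x ↔ (!b) = true)

/-- An overlap of size l contributes at most β^l relative to independence, so the second moment
exceeds the squared clique count by at most 1/(1 - β). The condition on the other vertices holds for
a given X with probability near 1, which gives the squared factor. -/
lemma le_prob_hasRootedClique (n k : ℕ) (p : I) (hp0 : 0 < (p : ℝ)) (hp1 : (p : ℝ) < 1) (b : Bool)
    (v : Fin (n + 1)) (hk : k < n) {β : ℝ} (hβ : β < 1)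
    (hβ' : (k : ℝ) ^ 2 / ((n - k) * (edgeProb p b * √p ^ k)) ≤ β)
    (hr : (n + 1) * edgeProb p (!b) ^ k ≤ 1) :
    (1 - (n + 1) * edgeProb p (!b) ^ k) ^ 2 * (1 - β) ≤
      prob (n + 1) p fun G => HasRootedClique b v k G := by
  have hnk : (0 : ℝ) < n - k := by
    have : (k : ℝ) < n := by exact_mod_cast hk
    linarith
  have hr0 : 0 < edgeProb p b := by cases b <;> simp [edgeProb, hp0, hp1]
  set r := edgeProb p b with hrdef
  set r' := edgeProb p (!b) with hr'def
  have hr'0 : 0 ≤ r' := edgeProb_nonneg p _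
  have hr'1 : r' ≤ 1 := edgeProb_le_one p _
  set S : Finset (Fin (n + 1)) := {v}ᶜ with hS
  have hScard : S.card = n := by simp [hS, Finset.card_compl]
  set B : Finset (Fin (n + 1)) → Set (SimpleGraph (Fin (n + 1))) := fun X =>
    rootedEvent b v X ∩ ⋂ z ∈ (insert v X)ᶜ, (uniformEvent (!b) z X)ᶜ with hB
  set a : ℝ := (p : ℝ) ^ k.choose 2 * r ^ k with ha
  have ha0 : 0 < a := by positivity
  set w : ℝ := (1 - r' ^ k) ^ (n - k) with hw
  have hvX : ∀ X ∈ S.powersetCard k, v ∉ X := by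
    intro X hX h
    have := (Finset.mem_powersetCard.1 hX).1 h
    simp [hS] at this
  have hPB : ∀ X ∈ S.powersetCard k,
      (SimpleGraph.binomialRandom (Fin (n + 1)) p).real (B X) = a * w := by
    intro X hX
    have hv := hvX X hX
    have hXk := (Finset.mem_powersetCard.1 hX).2
    have hz : ∀ z ∈ (insert v X)ᶜ, z ∉ X ∧ z ≠ v := by
      intro z hz
      simp at hz
      exact ⟨hz.2, hz.1⟩
    have hd : DependsOnEdges ((pairs X : Set (Sym2 (Fin (n + 1)))) ∪ star v X) (rootedEvent b v X) :=
      ((dependsOnEdges_cliqueEvent X).mono Set.subset_union_left).inter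
        ((dependsOnEdges_uniformEvent b v X).mono Set.subset_union_right)
    rw [hB]
    simp only
    rw [real_inter_biInter p _ hd (fun z => (star z X : Set (Sym2 (Fin (n + 1)))))
      _ (fun z _ => (dependsOnEdges_uniformEvent (!b) z X).compl), real_rootedEvent p b hv, hXk,
      Finset.prod_congr rfl fun z h => by rw [real_compl_uniformEvent p (!b) (hz z h).1, hXk],
      Finset.prod_const, Finset.card_compl, Finset.card_insert_of_notMem hv, hXk, Fintype.card_fin,
      Nat.add_sub_add_right]
    · intro z h
      rw [Set.disjoint_union_left]
      exact ⟨disjoint_pairs_star (hz z h).1, disjoint_star_star (hz z h).2.symm hv⟩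
    · exact fun z h w _ hzw => disjoint_star_star hzw (hz z h).1
  -- The condition on the remaining vertices is dropped in the joint event; the loss is only w⁻²,
  -- with w close to 1.
  have hPair : ∀ X ∈ S.powersetCard k, ∀ Y ∈ S.powersetCard k,
      (SimpleGraph.binomialRandom (Fin (n + 1)) p).real (B X ∩ B Y) ≤
        a ^ 2 * (1 / ((p : ℝ) ^ (X ∩ Y).card.choose 2 * r ^ (X ∩ Y).card)) := by
    intro X hX Y hY
    refine (measureReal_mono (Set.inter_subset_inter Set.inter_subset_left
      Set.inter_subset_left) (measure_ne_top _ _)).trans (le_of_eq ?_)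
    have h := real_rootedEvent_inter p b (hvX X hX) (hvX Y hY)
    rw [(Finset.mem_powersetCard.1 hX).2, (Finset.mem_powersetCard.1 hY).2] at h
    rw [mul_one_div, eq_div_iff (by positivity), h, sq]
  set M : ℝ := (n.choose k : ℝ) with hM
  have hM0 : 0 < M := by
    exact Nat.cast_pos.2 (Nat.choose_pos hk.le)
  have hβ0 : 0 ≤ β := le_trans (by positivity) hβ'
  have hInner : ∀ X ∈ S.powersetCard k, ∑ Y ∈ S.powersetCard k,
      (1 / ((p : ℝ) ^ (X ∩ Y).card.choose 2 * r ^ (X ∩ Y).card)) ≤ M * (1 - β)⁻¹ := by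
    intro X hX
    obtain ⟨hXS, hXk⟩ := Finset.mem_powersetCard.1 hX
    refine (sum_card_inter_le hXS k (f := fun l => 1 / ((p : ℝ) ^ l.choose 2 * r ^ l))
      (fun l => by positivity)).trans ?_
    refine le_trans ?_ (mul_le_mul_of_nonneg_left (geom_sum_le_inv hβ0 hβ (k + 1)) hM0.le)
    rw [Finset.mul_sum]
    refine Finset.sum_le_sum fun l hl => ?_
    have hlk : l ≤ k := by simp at hl; omega
    rw [hXk, hScard]
    calc _ ≤ (M * ((k : ℝ) ^ 2 / (n - k)) ^ l) * (1 / ((√p ^ k) ^ l * r ^ l)) := by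
          gcongr
          · exact choose_mul_choose_le hlk hk
          · exact sqrt_pow_pow_le_pow_choose_two hp0 hp1.le hlk
      _ = M * ((k : ℝ) ^ 2 / ((n - k) * (r * √p ^ k))) ^ l := by
          rw [div_pow, div_pow, mul_pow, mul_pow]
          field_simp
      _ ≤ _ := by gcongr
  have h2 := sq_sum_le_real_biUnion_mul (SimpleGraph.binomialRandom (Fin (n + 1)) p)
    (S.powersetCard k) B
  have hsum : ∑ X ∈ S.powersetCard k, ∑ Y ∈ S.powersetCard k,
      (SimpleGraph.binomialRandom (Fin (n + 1)) p).real (B X ∩ B Y) ≤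
      a ^ 2 * M ^ 2 * (1 - β)⁻¹ := by
    calc _ ≤ ∑ X ∈ S.powersetCard k, a ^ 2 * (M * (1 - β)⁻¹) := by
          refine Finset.sum_le_sum fun X hX => ?_
          refine (Finset.sum_le_sum fun Y hY => hPair X hX Y hY).trans ?_
          rw [← Finset.mul_sum]
          gcongr
          exact hInner X hX
      _ = _ := by
          rw [Finset.sum_const, Finset.card_powersetCard, hScard, nsmul_eq_mul]
          ring
  rw [Finset.sum_congr rfl hPB, Finset.sum_const, Finset.card_powersetCard, hScard,
    nsmul_eq_mul] at h2
  have hU : (SimpleGraph.binomialRandom (Fin (n + 1)) p).real (⋃ X ∈ S.powersetCard k, B X) ≤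
      prob (n + 1) p fun G => HasRootedClique b v k G := by
    refine measureReal_mono ?_
    intro G hG
    simp only [Set.mem_iUnion] at hG
    obtain ⟨X, hX, ⟨hc, hu⟩, hz⟩ := hG
    refine ⟨X, (Finset.mem_powersetCard.1 hX).2, hvX X hX, hc, hu, fun z h1 h3 => ?_⟩
    simp only [Set.mem_iInter] at hz
    exact hz z (by simp [h1, h3])
  have hone : 1 - (n + 1) * r' ^ k ≤ w := by
    have h1 : r' ^ k ≤ 1 := pow_le_one₀ hr'0 hr'1
    have h := one_add_mul_le_pow (a := - r' ^ k) (by linarith) (n - k)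
    have h3 : ((n - k : ℕ) : ℝ) ≤ n + 1 := by
      have : n - k ≤ n + 1 := by omega
      exact_mod_cast this
    have h4 : 0 ≤ r' ^ k := by positivity
    rw [hw, sub_eq_add_neg 1 (r' ^ k)]
    refine le_trans ?_ h
    nlinarith
  have hβpos : 0 < 1 - β := by linarith
  have h5 : (M * (a * w)) ^ 2 ≤ (prob (n + 1) p fun G => HasRootedClique b v k G) *
      (a ^ 2 * M ^ 2 * (1 - β)⁻¹) :=
    h2.trans (mul_le_mul hU hsum (Finset.sum_nonneg fun _ _ => Finset.sum_nonneg fun _ _ =>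
      measureReal_nonneg) (prob_nonneg _ _ _))
  have h6 : w ^ 2 * (1 - β) ≤ prob (n + 1) p fun G => HasRootedClique b v k G := by
    rw [← le_div_iff₀ hβpos, div_eq_mul_inv]
    have h7 : 0 < M ^ 2 * a ^ 2 := by positivity
    refine le_of_mul_le_mul_left ?_ h7
    calc _ = (M * (a * w)) ^ 2 := by ring
      _ ≤ _ := h5
      _ = _ := by ring
  refine le_trans ?_ h6
  gcongr

/-- X dominates the graph but is extendable by v; k > 0 ensures that v too has a neighbour in X. -/
lemma not_phiC3_of_hasRootedClique {n k : ℕ} (hk : 0 < k) {v : Fin n} {G : SimpleGraph (Fin n)}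
    (h : HasRootedClique true v k G) : ¬ PhiC1 G ∧ ¬ PhiC3 G := by
  obtain ⟨X, rfl, hv, hc, hu, hz⟩ := h
  obtain ⟨y, hy⟩ := Finset.card_pos.1 hk
  have hP : ¬ PhiC G (X : Set (Fin n)) := by
    rintro ⟨z, hzX, hzn⟩
    by_cases hzv : z = v
    · exact hzn y hy (hzv ▸ (hu y hy).2 rfl)
    · exact hz z (by simpa using hzX) hzv fun x hx => by simpa using hzn x hx
  refine ⟨fun h => hP (h X hc), fun h => (h X ⟨hc, hP⟩).2 ⟨v, by simpa using hv, ?_⟩⟩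
  exact fun x hx => (hu x hx).2 rfl

/-- X is a maximal clique missed by v; k > 0 ensures that v does not extend X vacuously. -/
lemma not_phiC2_of_hasRootedClique {n k : ℕ} (hk : 0 < k) {v : Fin n} {G : SimpleGraph (Fin n)}
    (h : HasRootedClique false v k G) : ¬ PhiC2 G := by
  obtain ⟨X, rfl, hv, hc, hu, hz⟩ := h
  obtain ⟨y, hy⟩ := Finset.card_pos.1 hk
  intro h
  refine h X ⟨hc, ?_⟩ ⟨v, by simpa using hv, fun x hx => by simpa using hu x hx⟩
  rintro ⟨z, hzX, hzn⟩
  by_cases hzv : z = v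
  · have := (hu y hy).1 (hzv ▸ hzn y hy)
    simp at this
  · exact hz z (by simpa using hzX) hzv fun x hx => by simpa using hzn x hx

end Rooted

/-! ### The case p > q²: cliques of logarithmic size. -/

section Supercritical

/-- The clique size used above the critical density. -/
noncomputable def cliqueSize (γ : ℝ) (n : ℕ) : ℕ := ⌊γ * Real.log n⌋₊

lemma tendsto_log_natCast : Tendsto (fun n : ℕ => Real.log n) atTop atTop :=
  Real.tendsto_log_atTop.comp tendsto_natCast_atTop_atTop

lemma tendsto_cliqueSize {γ : ℝ} (hγ : 0 < γ) : Tendsto (cliqueSize γ) atTop atTop :=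
  tendsto_nat_floor_atTop.comp (tendsto_log_natCast.const_mul_atTop hγ)

lemma cliqueSize_le {γ : ℝ} (hγ : 0 < γ) {n : ℕ} : (cliqueSize γ n : ℝ) ≤ γ * Real.log n :=
  Nat.floor_le (mul_nonneg hγ.le (Real.log_natCast_nonneg n))

lemma lt_cliqueSize_add_one (γ : ℝ) (n : ℕ) : γ * Real.log n < cliqueSize γ n + 1 :=
  Nat.lt_floor_add_one _

lemma pow_eq_exp_mul_log {r : ℝ} (hr : 0 < r) (k : ℕ) : r ^ k = Real.exp (k * Real.log r) := by
  rw [Real.exp_nat_mul, Real.exp_log hr]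

lemma tendsto_mul_pow_cliqueSize {γ r : ℝ} (hr0 : 0 < r) (hr1 : r < 1)
    (h : 1 < γ * (-Real.log r)) :
    Tendsto (fun n : ℕ => ((n : ℝ) + 1) * r ^ cliqueSize γ n) atTop (𝓝 0) := by
  have hlr : Real.log r < 0 := Real.log_neg hr0 hr1
  have hb : Tendsto (fun n : ℕ => 2 / r * Real.exp (-((γ * (-Real.log r) - 1) * Real.log n)))
      atTop (𝓝 0) := by
    have := (Real.tendsto_exp_neg_atTop_nhds_zero.comp
      (tendsto_log_natCast.const_mul_atTop (sub_pos.2 h))).const_mul (2 / r)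
    simpa using this
  refine squeeze_zero' (.of_forall fun n => by positivity) ?_ hb
  filter_upwards [eventually_ge_atTop 1] with n hn
  have hn' : (1 : ℝ) ≤ n := by exact_mod_cast hn
  have e1 : (n : ℝ) = Real.exp (Real.log n) := (Real.exp_log (by linarith)).symm
  have h2 : r ^ cliqueSize γ n ≤ r⁻¹ * Real.exp (-(γ * (-Real.log r) * Real.log n)) := by
    have e2 : r⁻¹ = Real.exp (-Real.log r) := by rw [Real.exp_neg, Real.exp_log hr0]
    rw [pow_eq_exp_mul_log hr0, e2, ← Real.exp_add, Real.exp_le_exp]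
    have := lt_cliqueSize_add_one γ n
    nlinarith
  calc ((n : ℝ) + 1) * r ^ cliqueSize γ n ≤ (2 * n) *
        (r⁻¹ * Real.exp (-(γ * (-Real.log r) * Real.log n))) := by gcongr; linarith
    _ = 2 / r * (Real.exp (Real.log n) * Real.exp (-(γ * (-Real.log r) * Real.log n))) := by
      rw [← e1]; ring
    _ = _ := by rw [← Real.exp_add]; ring_nf

lemma eventually_two_mul_cliqueSize_le {γ : ℝ} (hγ : 0 < γ) :
    ∀ᶠ n : ℕ in atTop, 2 * (cliqueSize γ n : ℝ) ≤ n := by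
  have h := (Real.isLittleO_log_id_atTop.comp_tendsto
    (tendsto_natCast_atTop_atTop (R := ℝ))).bound (c := 1 / (2 * γ)) (by positivity)
  filter_upwards [h] with n hn
  simp only [Function.comp, id, Real.norm_of_nonneg (Real.log_natCast_nonneg n),
    Real.norm_of_nonneg (Nat.cast_nonneg' (α := ℝ) n)] at hn
  have h1 := cliqueSize_le hγ (n := n)
  rw [div_mul_eq_mul_div, one_mul, le_div_iff₀ (by positivity)] at hn
  linarith

/-- Since √p^k ≥ n^(-γ log(1/p)/2), the ratio is at most of order (log n)² n^(-δ). -/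
lemma tendsto_overlap_cliqueSize {γ p r : ℝ} (hγ : 0 < γ) (hp0 : 0 < p) (hp1 : p < 1) (hr : 0 < r)
    (h : γ * (-Real.log p) < 2) :
    Tendsto (fun n : ℕ => (cliqueSize γ n : ℝ) ^ 2 /
      ((n - cliqueSize γ n) * (r * √p ^ cliqueSize γ n))) atTop (𝓝 0) := by
  have hlp : Real.log p < 0 := Real.log_neg hp0 hp1
  have hs : 0 < √p := Real.sqrt_pos.2 hp0
  set δ : ℝ := 1 - γ * (-Real.log p) / 2 with hδ
  have hδ0 : 0 < δ := by rw [hδ]; linarith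
  have hb : Tendsto (fun n : ℕ => 2 * γ ^ 2 / (r * δ ^ 2) *
      ((δ * Real.log n) ^ 2 * Real.exp (-(δ * Real.log n)))) atTop (𝓝 0) := by
    have := ((Real.tendsto_pow_mul_exp_neg_atTop_nhds_zero 2).comp
      (tendsto_log_natCast.const_mul_atTop hδ0)).const_mul (2 * γ ^ 2 / (r * δ ^ 2))
    simpa using this
  refine squeeze_zero' ?_ ?_ hb
  · filter_upwards [eventually_two_mul_cliqueSize_le hγ] with n hn
    have : (0 : ℝ) ≤ cliqueSize γ n := Nat.cast_nonneg _
    have : (0 : ℝ) ≤ n - cliqueSize γ n := by linarith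
    positivity
  · filter_upwards [eventually_two_mul_cliqueSize_le hγ, eventually_ge_atTop 1] with n hn hn1
    have hn' : (1 : ℝ) ≤ n := by exact_mod_cast hn1
    have e1 : (n : ℝ) = Real.exp (Real.log n) := (Real.exp_log (by linarith)).symm
    have h1 := cliqueSize_le hγ (n := n)
    have h2 : Real.exp (-(γ * (-Real.log p) / 2 * Real.log n)) ≤ √p ^ cliqueSize γ n := by
      rw [pow_eq_exp_mul_log hs, Real.exp_le_exp, Real.log_sqrt hp0.le]
      nlinarith
    calc (cliqueSize γ n : ℝ) ^ 2 / ((n - cliqueSize γ n) * (r * √p ^ cliqueSize γ n))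
        ≤ (γ * Real.log n) ^ 2 / ((n / 2) *
          (r * Real.exp (-(γ * (-Real.log p) / 2 * Real.log n)))) := by
          gcongr <;> linarith
      _ = (γ * Real.log n) ^ 2 / (r / 2 *
          (Real.exp (Real.log n) * Real.exp (-(γ * (-Real.log p) / 2 * Real.log n)))) := by
          rw [← e1]; ring_nf
      _ = (γ * Real.log n) ^ 2 / (r / 2 * Real.exp (δ * Real.log n)) := by
          rw [← Real.exp_add, hδ]; ring_nf
      _ = _ := by
          rw [Real.exp_neg]
          field_simp

lemma tendsto_prob_hasRootedClique (p : I) (hp0 : 0 < (p : ℝ)) (hp1 : (p : ℝ) < 1) (b : Bool)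
    {γ : ℝ} (hγ : 0 < γ) (h1 : 1 < γ * (-Real.log (edgeProb p (!b))))
    (h2 : γ * (-Real.log p) < 2) :
    Tendsto (fun n => prob (n + 1) p fun G => HasRootedClique b 0 (cliqueSize γ n) G)
      atTop (𝓝 1) := by
  have hr0 : ∀ b, 0 < edgeProb p b := by intro b; cases b <;> simp [edgeProb, hp0, hp1]
  have hr1 : ∀ b, edgeProb p b < 1 := by intro b; cases b <;> simp [edgeProb, hp0, hp1]
  have t1 := tendsto_mul_pow_cliqueSize (hr0 (!b)) (hr1 (!b)) h1
  have t2 := tendsto_overlap_cliqueSize hγ hp0 hp1 (hr0 b) h2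
  have t3 : Tendsto (fun n : ℕ => (1 - ((n : ℝ) + 1) * edgeProb p (!b) ^ cliqueSize γ n) ^ 2 *
      (1 - (cliqueSize γ n : ℝ) ^ 2 / ((n - cliqueSize γ n) *
        (edgeProb p b * √(p : ℝ) ^ cliqueSize γ n)))) atTop (𝓝 1) := by
    have := ((t1.const_sub 1).pow 2).mul (t2.const_sub 1)
    simpa using this
  refine tendsto_of_tendsto_of_tendsto_of_le_of_le' t3 tendsto_const_nhds ?_
    (.of_forall fun n => prob_le_one _ _ _)
  filter_upwards [t1.eventually_lt_const one_pos, t2.eventually_lt_const one_pos,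
    eventually_two_mul_cliqueSize_le hγ, (tendsto_cliqueSize hγ).eventually_ge_atTop 1]
    with n hn1 hn2 hn3 hn4
  refine le_prob_hasRootedClique n _ p hp0 hp1 b 0 ?_ hn2 le_rfl hn1.le
  have : 2 * cliqueSize γ n ≤ n := by exact_mod_cast hn3
  omega

lemma prob_add_sub_one_le (n : ℕ) (p : I) (Q R : SimpleGraph (Fin n) → Prop) :
    prob n p Q + prob n p R - 1 ≤ prob n p fun G => Q G ∧ R G := by
  have h := measureReal_union_add_inter (μ := SimpleGraph.binomialRandom (Fin n) p)
    (s := {G | Q G}) (t := {G | R G}) (measurableSet_of_finite_graph _)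
  have h1 : (SimpleGraph.binomialRandom (Fin n) p).real ({G | Q G} ∪ {G | R G}) ≤ 1 :=
    measureReal_le_one
  have h2 : prob n p (fun G => Q G ∧ R G) =
    (SimpleGraph.binomialRandom (Fin n) p).real ({G | Q G} ∩ {G | R G}) := rfl
  rw [h2]
  unfold prob
  linarith

lemma tendsto_prob_not_phiC (p : I) (hp0 : 0 < (p : ℝ)) (hp1 : (p : ℝ) < 1)
    (hp : (1 - p : ℝ) ^ 2 < p) :
    Tendsto (fun n => prob n p fun G => ¬ PhiC1 G ∧ ¬ PhiC2 G ∧ ¬ PhiC3 G) atTop (𝓝 1) := by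
  have hq0 : (0 : ℝ) < 1 - p := by linarith
  have hlp : Real.log p < 0 := Real.log_neg hp0 hp1
  have hlq : Real.log (1 - p) < 0 := Real.log_neg hq0 (by linarith)
  have hl : 2 * Real.log (1 - p) < Real.log p := by
    have := Real.log_lt_log (by positivity) hp
    rwa [Real.log_pow] at this
  -- The lower bounds make n p^k and n (1-p)^k vanish, the upper one keeps overlaps negligible. That
  -- 1/log(1/(1-p)) lies below 2/log(1/p) is exactly (1-p)² < p.
  obtain ⟨γ, hγ1, hγ2⟩ : ∃ γ, max (1 / (-Real.log p)) (1 / (-Real.log (1 - p))) < γ ∧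
      γ < 2 / (-Real.log p) := by
    refine exists_between (max_lt ?_ ?_)
    · gcongr
      · linarith
      · norm_num
    · rw [div_lt_div_iff₀ (by linarith) (by linarith)]
      linarith
  obtain ⟨hγp, hγq⟩ := max_lt_iff.1 hγ1
  have hγ : 0 < γ := lt_trans (by apply one_div_pos.2; linarith) hγp
  rw [div_lt_iff₀ (by linarith)] at hγp hγq
  rw [lt_div_iff₀ (by linarith)] at hγ2
  have t1 := tendsto_prob_hasRootedClique p hp0 hp1 true hγ (by simpa [edgeProb] using hγq) hγ2
  have t2 := tendsto_prob_hasRootedClique p hp0 hp1 false hγ (by simpa [edgeProb] using hγp) hγ2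
  have t3 := (t1.add t2).sub_const 1
  norm_num only at t3
  rw [← tendsto_add_atTop_iff_nat 1]
  refine tendsto_of_tendsto_of_tendsto_of_le_of_le' t3 tendsto_const_nhds ?_
    (.of_forall fun n => prob_le_one _ _ _)
  filter_upwards [(tendsto_cliqueSize hγ).eventually_ge_atTop 1] with n hn
  refine (prob_add_sub_one_le _ _ _ _).trans (prob_mono _ _ fun G hG => ?_)
  obtain ⟨h1, h3⟩ := not_phiC3_of_hasRootedClique hn hG.1
  exact ⟨h1, not_phiC2_of_hasRootedClique hn hG.2, h3⟩

end Supercritical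

/-! ### The case p = q² with y near k: first moment and overlap sums. -/

section CriticalNumerics

/-- A crude Stirling bound, by induction from (k/(k+1))^(k+1) ≤ 1/e. -/
lemma factorial_le_mul_pow_mul_exp {k : ℕ} (hk : 1 ≤ k) :
    (k.factorial : ℝ) ≤ (k : ℝ) ^ (k + 1) * Real.exp (1 - k) := by
  induction k, hk using Nat.le_induction with
  | base => simp
  | succ k hk ih =>
    have hk0 : (0 : ℝ) < k := by exact_mod_cast hk
    have h1 : ((k : ℝ) / (k + 1)) ^ (k + 1) ≤ Real.exp (-1) := by
      have h : (k : ℝ) / (k + 1) ≤ Real.exp (-(1 / (k + 1))) := by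
        refine le_trans (le_of_eq ?_) (Real.add_one_le_exp _)
        field_simp
        ring
      refine (pow_le_pow_left₀ (by positivity) h _).trans (le_of_eq ?_)
      rw [← Real.exp_nat_mul]
      push_cast
      field_simp
    rw [div_pow, div_le_iff₀ (by positivity)] at h1
    rw [Nat.factorial_succ]
    push_cast
    calc ((k : ℝ) + 1) * k.factorial ≤ (k + 1) * ((k : ℝ) ^ (k + 1) * Real.exp (1 - k)) := by gcongr
      _ ≤ (k + 1) * ((Real.exp (-1) * (k + 1) ^ (k + 1)) * Real.exp (1 - k)) := by gcongr
      _ = (k + 1) ^ (k + 1 + 1) * (Real.exp (-1) * Real.exp (1 - k)) := by ring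
      _ = _ := by rw [← Real.exp_add]; ring_nf

/-- The regime in which the expected number of extendable dominating `k`-cliques at the critical
density is bounded below. -/
structure DenseRegime (q : ℝ) (n k : ℕ) : Prop where
  pos : 0 < q
  lt_one : q < 1
  one_le : 1 ≤ k
  le_mean : (k : ℝ) ≤ n * q ^ k
  mean_le : n * q ^ k ≤ k + 1
  -- The cube is what large overlaps need: one factor k + 1 for choosing vertices, one from the
  -- mean, and one from the choice of the extending vertex.
  cube_le : ((k : ℝ) + 1) ^ 3 * √q ^ k ≤ 1 / 4
  lin_le : ((k : ℝ) + 1) * √q ^ (k - 1) ≤ 1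

variable {q : ℝ} {n k : ℕ}

lemma DenseRegime.sqrt_pow_pos (h : DenseRegime q n k) (j : ℕ) : 0 < √q ^ j :=
  pow_pos (Real.sqrt_pos.2 h.pos) j

lemma pow_eq_sqrt_pow (h : 0 ≤ q) (j : ℕ) : q ^ j = √q ^ (2 * j) := by
  rw [pow_mul, Real.sq_sqrt h]

lemma DenseRegime.pow_le_sqrt_pow (h : DenseRegime q n k) (j : ℕ) : q ^ j ≤ √q ^ j :=
  pow_le_pow_left₀ h.pos.le (Real.le_sqrt_of_sq_le (by nlinarith [h.pos, h.lt_one])) j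

lemma DenseRegime.sq_mul_le (h : DenseRegime q n k) : 4 * ((k : ℝ) + 1) ^ 2 * √q ^ k ≤ 1 := by
  have h1 := h.cube_le
  have h2 := h.sqrt_pow_pos k
  have h3 : ((k : ℝ) + 1) ^ 2 * √q ^ k ≤ ((k : ℝ) + 1) ^ 3 * √q ^ k := by
    gcongr
    · have : (0 : ℝ) ≤ k := Nat.cast_nonneg k
      linarith
    · norm_num
  linarith

lemma DenseRegime.four_mul_sq_le (h : DenseRegime q n k) : 4 * ((k : ℝ) + 1) ^ 2 ≤ n := by
  have hk : (1 : ℝ) ≤ k := by exact_mod_cast h.one_le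
  have h2 := h.sq_mul_le
  have h3 := h.pow_le_sqrt_pow k
  have hq : 0 < q ^ k := pow_pos h.pos k
  have h4 : 4 * ((k : ℝ) + 1) ^ 2 * q ^ k ≤ n * q ^ k :=
    calc 4 * ((k : ℝ) + 1) ^ 2 * q ^ k ≤ 4 * ((k : ℝ) + 1) ^ 2 * √q ^ k := by gcongr
      _ ≤ 1 := h2
      _ ≤ _ := hk.trans h.le_mean
  exact le_of_mul_le_mul_right h4 hq

/-- Stirling gives k^(k+1)/k! ≥ e^(k-1), and y ≤ k + 1 gives e^(-y) ≥ e^(-k-1), whence e^(-2). The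
factor 1/2 pays for replacing a falling factorial by n^(k+1), by Bernoulli and k² ≪ n. -/
lemma DenseRegime.expected_ge (h : DenseRegime q n k) :
    Real.exp (-2) / 2 ≤ ((k + 1 : ℕ) * n.choose (k + 1) : ℝ) *
      ((q ^ 2) ^ (k + 1).choose 2 * Real.exp (-(n * q ^ k))) := by
  have hk : (1 : ℝ) ≤ k := by exact_mod_cast h.one_le
  have hn := h.four_mul_sq_le
  have hn0 : (0 : ℝ) < n := by nlinarith
  have hkn : k ≤ n := by
    have : (k : ℝ) ≤ n := by nlinarith
    exact_mod_cast this
  have e : (q ^ 2) ^ (k + 1).choose 2 = (q ^ k) ^ (k + 1) := by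
    rw [← pow_mul, ← pow_mul]
    congr 1
    have := two_mul_choose_two_add (k + 1)
    nlinarith
  have h1 : ((k + 1 : ℕ) * n.choose (k + 1) : ℝ) * k.factorial ≥ ((n : ℝ) - k) ^ (k + 1) := by
    have h2 := Nat.pow_sub_le_descFactorial n (k + 1)
    rw [Nat.descFactorial_eq_factorial_mul_choose, Nat.factorial_succ, Nat.add_sub_add_right] at h2
    rw [← Nat.cast_sub hkn]
    have h3 : (n - k) ^ (k + 1) ≤ (k + 1) * n.choose (k + 1) * k.factorial := by
      refine h2.trans (le_of_eq ?_); ring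
    exact_mod_cast h3
  have h2 : (n : ℝ) ^ (k + 1) / 2 ≤ ((n : ℝ) - k) ^ (k + 1) := by
    have h3 := one_add_mul_le_pow (a := -(k / n : ℝ)) (by
      have : (k / n : ℝ) ≤ 1 := by rw [div_le_one hn0]; exact_mod_cast hkn
      linarith) (k + 1)
    have h4 : (1 : ℝ) / 2 ≤ 1 + (k + 1 : ℕ) * -(k / n : ℝ) := by
      have : ((k : ℝ) + 1) * (k / n) ≤ 1 / 2 := by
        rw [← mul_div_assoc, div_le_iff₀ hn0]
        nlinarith
      push_cast
      linarith
    calc (n : ℝ) ^ (k + 1) / 2 = (n : ℝ) ^ (k + 1) * (1 / 2) := by ring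
      _ ≤ (n : ℝ) ^ (k + 1) * (1 + -(k / n : ℝ)) ^ (k + 1) := by gcongr; exact h4.trans h3
      _ = _ := by rw [← mul_pow]; congr 1; field_simp; ring
  have h5 : (n : ℝ) ^ (k + 1) / 2 / k.factorial ≤ ((k + 1 : ℕ) * n.choose (k + 1) : ℝ) := by
    rw [div_le_iff₀ (by positivity)]
    exact h2.trans h1
  have hy := h.le_mean
  have hq := h.pos
  rw [e]
  calc Real.exp (-2) / 2 = (k : ℝ) ^ (k + 1) / 2 /
        ((k : ℝ) ^ (k + 1) * Real.exp (1 - k)) * Real.exp (-(k + 1)) := by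
        have : Real.exp (-2) = Real.exp (-(k + 1)) / Real.exp (1 - k) := by
          rw [← Real.exp_sub]; ring_nf
        rw [this]
        field_simp
    _ ≤ (n * q ^ k) ^ (k + 1) / 2 / k.factorial * Real.exp (-(n * q ^ k)) := by
        gcongr
        · exact factorial_le_mul_pow_mul_exp h.one_le
        · exact h.mean_le
    _ = ((n : ℝ) ^ (k + 1) / 2 / k.factorial) *
        ((q ^ k) ^ (k + 1) * Real.exp (-(n * q ^ k))) := by rw [mul_pow]; ring
    _ ≤ _ := by gcongr

/-- For l up to half the clique size, each shared vertex costs a factor about k²/n in the count and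
returns at most √q^(-k), while the exponential stays below e. -/
lemma DenseRegime.small_overlap (h : DenseRegime q n k) {l : ℕ} (hl : 2 * l ≤ k + 1) :
    (((k + 1).choose l * (n - (k + 1)).choose (k + 1 - l) : ℕ) : ℝ) *
      (((q ^ 2) ^ l.choose 2)⁻¹ * Real.exp (n * q ^ k * q ^ (k - l))) ≤
      Real.exp 1 * n.choose (k + 1) * (1 / 2) ^ l := by
  have hk : (1 : ℝ) ≤ k := by exact_mod_cast h.one_le
  have hn := h.four_mul_sq_le
  have hq := h.pos
  have hs : √q ≤ 1 := Real.sqrt_le_one.2 h.lt_one.le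
  have hsk := h.sqrt_pow_pos k
  have hn2 : 2 * ((k : ℝ) + 1) ≤ n := by nlinarith
  have hkn : k + 1 < n := by
    have : ((k + 1 : ℕ) : ℝ) < n := by push_cast; linarith
    exact_mod_cast this
  have h1 := choose_mul_choose_le (m := n) (k := k + 1) (l := l) (by have := h.one_le; omega) hkn
  have h2 : (√q ^ k) ^ l ≤ (q ^ 2) ^ l.choose 2 := by
    rw [← pow_mul q, pow_eq_sqrt_pow hq.le, ← pow_mul]
    refine pow_le_pow_of_le_one (Real.sqrt_nonneg _) hs ?_
    have := two_mul_choose_two_add l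
    nlinarith
  have h3 : n * q ^ k * q ^ (k - l) ≤ 1 := by
    refine le_trans ?_ h.lin_le
    have : q ^ (k - l) ≤ √q ^ (k - 1) := by
      rw [pow_eq_sqrt_pow hq.le]
      exact pow_le_pow_of_le_one (Real.sqrt_nonneg _) hs (by omega)
    gcongr
    exact h.mean_le
  have h4 : ((k + 1 : ℕ) : ℝ) ^ 2 / (n - (k + 1 : ℕ)) * (√q ^ k)⁻¹ ≤ 1 / 2 := by
    push_cast
    have hd : (0 : ℝ) < n - (k + 1) := by linarith
    rw [← div_eq_mul_inv, div_div, div_le_iff₀ (by positivity)]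
    have h5 := h.sq_mul_le
    have h6 : 1 ≤ n * √q ^ k * √q ^ k := by
      have := h.le_mean
      rw [pow_eq_sqrt_pow hq.le, two_mul, pow_add, ← mul_assoc] at this
      linarith
    have h7 : 4 * ((k : ℝ) + 1) ^ 2 ≤ n * √q ^ k := by
      refine le_of_mul_le_mul_right ?_ hsk
      linarith
    nlinarith
  have hd : (0 : ℝ) < n - (k + 1 : ℕ) := by push_cast; linarith
  calc _ ≤ (n.choose (k + 1) * (((k + 1 : ℕ) : ℝ) ^ 2 / (n - (k + 1 : ℕ))) ^ l) *
        (((√q ^ k) ^ l)⁻¹ * Real.exp 1) := by gcongr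
    _ = Real.exp 1 * n.choose (k + 1) *
        (((k + 1 : ℕ) : ℝ) ^ 2 / (n - (k + 1 : ℕ)) * (√q ^ k)⁻¹) ^ l := by
        rw [mul_pow, inv_pow]; ring
    _ ≤ _ := by
      gcongr

/-- Large overlaps are measured from the diagonal: `DenseRegime.expected_ge` bounds the diagonal
term, and each of the k + 1 - l vertices not shared costs a small factor. -/
lemma DenseRegime.large_overlap (h : DenseRegime q n k) {l : ℕ} (hlk : l ≤ k)
    (hl : k + 1 < 2 * l) :
    (((k + 1).choose l * (n - (k + 1)).choose (k + 1 - l) : ℕ) : ℝ) *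
      (((q ^ 2) ^ l.choose 2)⁻¹ * Real.exp (n * q ^ k * q ^ (k - l))) ≤
      2 * Real.exp 2 * n.choose (k + 1) * (1 / 2) ^ (k + 1 - l) := by
  have hk : (1 : ℝ) ≤ k := by exact_mod_cast h.one_le
  have hq := h.pos
  have hs : √q ≤ 1 := Real.sqrt_le_one.2 h.lt_one.le
  have hsk := h.sqrt_pow_pos k
  obtain ⟨j, hj⟩ : ∃ j, k = l + j := ⟨k - l, by omega⟩
  have ej : k + 1 - l = j + 1 := by omega
  rw [ej]
  have h1 : (((k + 1).choose l * (n - (k + 1)).choose (j + 1) : ℕ) : ℝ) ≤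
      (((k : ℝ) + 1) * n) ^ (j + 1) := by
    have a1 : (k + 1).choose l ≤ (k + 1) ^ (j + 1) := by
      rw [← Nat.choose_symm (by omega), ej]
      exact Nat.choose_le_pow _ _
    have a2 : (n - (k + 1)).choose (j + 1) ≤ n ^ (j + 1) :=
      (Nat.choose_le_pow _ _).trans (Nat.pow_le_pow_left (Nat.sub_le _ _) _)
    rw [mul_pow]
    exact_mod_cast Nat.mul_le_mul a1 a2
  have h2 : Real.exp (n * q ^ k * q ^ (k - l)) ≤ Real.exp (n * q ^ k) := by
    rw [Real.exp_le_exp]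
    exact mul_le_of_le_one_right (by positivity) (pow_le_one₀ hq.le h.lt_one.le)
  have h3 : ((q ^ 2) ^ l.choose 2)⁻¹ ≤
      ((q ^ 2) ^ (k + 1).choose 2)⁻¹ * (q ^ k * √q ^ k) ^ (j + 1) := by
    have e1 : (q ^ 2) ^ (k + 1).choose 2 = (q ^ 2) ^ l.choose 2 * (q ^ (k + l)) ^ (j + 1) := by
      rw [← pow_mul, ← pow_mul, ← pow_mul, ← pow_add]
      congr 1
      have b1 := two_mul_choose_two_add l
      have b2 := two_mul_choose_two_add (k + 1)
      subst hj
      nlinarith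
    have e2 : (q ^ (k + l)) ^ (j + 1) ≤ (q ^ k * √q ^ k) ^ (j + 1) := by
      rw [pow_add q k l]
      gcongr
      rw [pow_eq_sqrt_pow hq.le l]
      exact pow_le_pow_of_le_one (Real.sqrt_nonneg _) hs (by omega)
    rw [e1, mul_inv, mul_assoc]
    refine le_mul_of_one_le_right (by positivity) ?_
    rw [← div_eq_inv_mul, le_div_iff₀ (by positivity), one_mul]
    exact e2
  have h4 : ((q ^ 2) ^ (k + 1).choose 2)⁻¹ * Real.exp (n * q ^ k) ≤
      2 * Real.exp 2 * (((k : ℝ) + 1) * n.choose (k + 1)) := by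
    have h5 := h.expected_ge
    push_cast at h5
    rw [Real.exp_neg, Real.exp_neg] at h5
    have hE := Real.exp_pos (n * q ^ k)
    have hE2 := Real.exp_pos 2
    have hP : 0 < (q ^ 2) ^ (k + 1).choose 2 := by positivity
    rw [inv_mul_le_iff₀ hP]
    calc Real.exp (n * q ^ k) = 2 * Real.exp 2 * Real.exp (n * q ^ k) * ((Real.exp 2)⁻¹ / 2) := by
          field_simp
      _ ≤ 2 * Real.exp 2 * Real.exp (n * q ^ k) *
        (((k : ℝ) + 1) * n.choose (k + 1) *
          ((q ^ 2) ^ (k + 1).choose 2 * (Real.exp (n * q ^ k))⁻¹)) := by gcongr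
      _ = _ := by field_simp
  -- The isolated factor k + 1 is absorbed into the power, which is possible because j + 1 ≥ 1; this
  -- excludes l = k + 1.
  have h6 : ((k : ℝ) + 1) * (((k : ℝ) + 1) * n * (q ^ k * √q ^ k)) ^ (j + 1) ≤
      (1 / 2) ^ (j + 1) := by
    have h7 : ((k : ℝ) + 1) * n * (q ^ k * √q ^ k) ≤ ((k : ℝ) + 1) ^ 2 * √q ^ k := by
      calc ((k : ℝ) + 1) * n * (q ^ k * √q ^ k) = ((k : ℝ) + 1) * (n * q ^ k) * √q ^ k := by ring
        _ ≤ ((k : ℝ) + 1) * (k + 1) * √q ^ k := by gcongr; exact h.mean_le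
        _ = _ := by ring
    calc _ ≤ ((k : ℝ) + 1) ^ (j + 1) * (((k : ℝ) + 1) ^ 2 * √q ^ k) ^ (j + 1) := by
          gcongr
          exact le_self_pow₀ (by linarith) (by omega)
      _ = (((k : ℝ) + 1) ^ 3 * √q ^ k) ^ (j + 1) := by rw [← mul_pow]; ring
      _ ≤ _ := by
        gcongr
        exact h.cube_le.trans (by norm_num)
  calc _ ≤ (((k : ℝ) + 1) * n) ^ (j + 1) * ((((q ^ 2) ^ (k + 1).choose 2)⁻¹ *
        (q ^ k * √q ^ k) ^ (j + 1)) * Real.exp (n * q ^ k)) := by gcongr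
    _ = (((k : ℝ) + 1) * n * (q ^ k * √q ^ k)) ^ (j + 1) *
        (((q ^ 2) ^ (k + 1).choose 2)⁻¹ * Real.exp (n * q ^ k)) := by
        rw [mul_pow (((k : ℝ) + 1) * n)]; ring
    _ ≤ (((k : ℝ) + 1) * n * (q ^ k * √q ^ k)) ^ (j + 1) *
        (2 * Real.exp 2 * (((k : ℝ) + 1) * n.choose (k + 1))) := by gcongr
    _ = 2 * Real.exp 2 * n.choose (k + 1) *
        (((k : ℝ) + 1) * (((k : ℝ) + 1) * n * (q ^ k * √q ^ k)) ^ (j + 1)) := by ring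
    _ ≤ _ := by gcongr

lemma DenseRegime.sum_overlap_le (h : DenseRegime q n k) :
    ∑ l ∈ Finset.range (k + 1),
      (((k + 1).choose l * (n - (k + 1)).choose (k + 1 - l) : ℕ) : ℝ) *
      (((q ^ 2) ^ l.choose 2)⁻¹ * Real.exp (n * q ^ k * q ^ (k - l))) ≤
      8 * Real.exp 2 * n.choose (k + 1) := by
  have hgeo : ∑ l ∈ Finset.range (k + 1 + 1), (1 / 2 : ℝ) ^ l ≤ 2 := by
    refine (geom_sum_le_inv (by norm_num) (by norm_num) _).trans (by norm_num)
  have hgeo1 : ∑ l ∈ Finset.range (k + 1), (1 / 2 : ℝ) ^ l ≤ 2 := by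
    refine (geom_sum_le_inv (by norm_num) (by norm_num) _).trans (by norm_num)
  have hrefl : ∑ l ∈ Finset.range (k + 1), (1 / 2 : ℝ) ^ (k + 1 - l) ≤ 2 := by
    rw [← Finset.sum_range_reflect (fun l => (1 / 2 : ℝ) ^ l) (k + 1 + 1)] at hgeo
    refine le_trans ?_ hgeo
    rw [Finset.sum_range_succ _ (k + 1)]
    exact le_add_of_nonneg_right (by positivity)
  have he : Real.exp 1 ≤ 2 * Real.exp 2 := by
    have : Real.exp 1 ≤ Real.exp 2 := Real.exp_le_exp.2 (by norm_num)
    linarith [Real.exp_pos 2]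
  calc _ ≤ ∑ l ∈ Finset.range (k + 1), 2 * Real.exp 2 * n.choose (k + 1) *
        ((1 / 2 : ℝ) ^ l + (1 / 2 : ℝ) ^ (k + 1 - l)) := by
        refine Finset.sum_le_sum fun l hl => ?_
        have hl' : l ≤ k := by simp at hl; omega
        rcases Nat.lt_or_ge (k + 1) (2 * l) with h1 | h1
        · refine (h.large_overlap hl' h1).trans ?_
          gcongr
          exact le_add_of_nonneg_left (by positivity)
        · refine (h.small_overlap h1).trans ?_
          gcongr
          exact le_add_of_nonneg_right (by positivity)
    _ = 2 * Real.exp 2 * n.choose (k + 1) * (∑ l ∈ Finset.range (k + 1), (1 / 2 : ℝ) ^ l +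
        ∑ l ∈ Finset.range (k + 1), (1 / 2 : ℝ) ^ (k + 1 - l)) := by
        rw [← Finset.mul_sum, Finset.sum_add_distrib]
    _ ≤ 2 * Real.exp 2 * n.choose (k + 1) * (2 + 2) := by gcongr
    _ = _ := by ring

end CriticalNumerics

/-! ### The case p = q²: second moment along dense orders, and non-convergence. -/

section CriticalSecondMoment

variable {q : ℝ} {n k : ℕ}

lemma DenseRegime.mul_pow_le (h : DenseRegime q n k) : ((k : ℝ) + 1) * q ^ k ≤ 1 / 4 := by
  have h1 := h.sq_mul_le
  have h2 := h.pow_le_sqrt_pow k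
  have hk : (1 : ℝ) ≤ k := by exact_mod_cast h.one_le
  have h3 := h.sqrt_pow_pos k
  calc ((k : ℝ) + 1) * q ^ k ≤ ((k : ℝ) + 1) ^ 2 * √q ^ k := by
        have : (k : ℝ) + 1 ≤ ((k : ℝ) + 1) ^ 2 := by nlinarith
        have hq : 0 < q ^ k := pow_pos h.pos k
        gcongr
    _ ≤ _ := by linarith

lemma exp_neg_le_one_sub {u : ℝ} (h1 : u ≤ 1 / 2) :
    Real.exp (-(u + 2 * u ^ 2)) ≤ 1 - u := by
  have h2 := Real.add_one_le_exp (u + 2 * u ^ 2)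
  rw [Real.exp_neg]
  refine inv_le_of_inv_le₀ (by linarith) (le_trans ?_ h2)
  rw [inv_le_iff_one_le_mul₀ (by linarith)]
  nlinarith [sq_nonneg u]

lemma DenseRegime.dominating_ge (h : DenseRegime q n k) :
    Real.exp (-(n * q ^ k) - 1 / 2) ≤ (1 - q ^ k) ^ (n - (k + 1)) := by
  have hk : (1 : ℝ) ≤ k := by exact_mod_cast h.one_le
  have hu := h.mul_pow_le
  have hq : 0 < q ^ k := pow_pos h.pos k
  have hy := h.mean_le
  have hu2 : q ^ k ≤ 1 / 2 := by nlinarith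
  calc Real.exp (-(n * q ^ k) - 1 / 2) ≤ Real.exp (-(q ^ k + 2 * (q ^ k) ^ 2)) ^ n := by
        rw [← Real.exp_nat_mul, Real.exp_le_exp]
        nlinarith
    _ ≤ (1 - q ^ k) ^ n := by
        gcongr
        exact exp_neg_le_one_sub hu2
    _ ≤ _ := pow_le_pow_of_le_one (by linarith) (by linarith) (Nat.sub_le _ _)

/-- Sharing i vertices raises the exponent by only y q^(k-i). The final 1 pays for the s excluded
vertices, since s · 2q^k ≤ 4 (k+1) q^k ≤ 1. -/
lemma DenseRegime.pair_dominating_le (h : DenseRegime q n k) {i s : ℕ}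
    (hs : s ≤ 2 * (k + 1)) (hsn : s ≤ n) :
    (1 - q ^ k - q ^ k + q ^ (k + (k - i))) ^ (n - s) ≤
      Real.exp (-(2 * (n * q ^ k)) + n * q ^ k * q ^ (k - i) + 1) := by
  have hu := h.mul_pow_le
  have hq : 0 < q ^ k := pow_pos h.pos k
  have hd : 0 < q ^ (k - i) := pow_pos h.pos _
  have hd1 : q ^ (k - i) ≤ 1 := pow_le_one₀ h.pos.le h.lt_one.le
  have hd2 : q ^ k ≤ q ^ (k - i) := pow_le_pow_of_le_one h.pos.le h.lt_one.le (Nat.sub_le _ _)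
  have hs' : (s : ℝ) ≤ 2 * (k + 1) := by exact_mod_cast hs
  rw [pow_add]
  set t := q ^ k * (2 - q ^ (k - i)) with ht
  have e : 1 - q ^ k - q ^ k + q ^ k * q ^ (k - i) = 1 - t := by rw [ht]; ring
  have ht0 : 0 ≤ t := by rw [ht]; apply mul_nonneg hq.le; linarith
  have h1 : 0 ≤ 1 - t := by rw [← e]; nlinarith [sq_nonneg (1 - q ^ k)]
  have h2 : 1 - t ≤ Real.exp (-t) := by have := Real.add_one_le_exp (-t); linarith
  rw [e]
  refine (pow_le_pow_left₀ h1 h2 _).trans ?_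
  rw [← Real.exp_nat_mul, Real.exp_le_exp, Nat.cast_sub hsn]
  have h3 : s * t ≤ 1 := by
    have h4 : t ≤ 2 * q ^ k := by rw [ht]; nlinarith
    have h5 : (s : ℝ) * t ≤ (2 * (k + 1)) * (2 * q ^ k) := by gcongr
    linarith
  have h6 : n * t = 2 * (n * q ^ k) - n * q ^ k * q ^ (k - i) := by rw [ht]; ring
  linarith

/-- The ratio between the joint probability of two extendable dominating cliques and the product of
their probabilities, up to a constant, in terms of the overlaps. -/
noncomputable def overlapWeight (q : ℝ) (n k l i : ℕ) : ℝ :=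
  ((q ^ 2) ^ l.choose 2)⁻¹ * Real.exp (n * q ^ k * q ^ (k - i))

lemma overlapWeight_nonneg (q : ℝ) (n k l i : ℕ) : 0 ≤ overlapWeight q n k l i := by
  unfold overlapWeight
  positivity

lemma card_erase_of_mem_powersetCard {V : Type*} [DecidableEq V] {S Y : Finset V}
    (hY : Y ∈ S.powersetCard (k + 1)) {x : V} (hx : x ∈ Y) : (Y.erase x).card = k := by
  rw [Finset.card_erase_of_mem hx, (Finset.mem_powersetCard.1 hY).2, Nat.add_sub_cancel]

lemma DenseRegime.sum_overlapWeight_le (h : DenseRegime q n k) {Y : Finset (Fin n)}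
    (hY : Y ∈ (Finset.univ : Finset (Fin n)).powersetCard (k + 1)) {x : Fin n} (hx : x ∈ Y) :
    ∑ Z ∈ (Finset.univ : Finset (Fin n)).powersetCard (k + 1), ∑ z ∈ Z,
      overlapWeight q n k (Y ∩ Z).card (Y.erase x ∩ Z.erase z).card ≤
      (2 * Real.exp 2 * (1 + 1 / (1 - q)) + 8 * Real.exp 2) *
        ((k + 1 : ℕ) * n.choose (k + 1) : ℝ) := by
  have hq := h.pos
  have hq1 : 0 < 1 - q := by linarith [h.lt_one]
  have hYc := (Finset.mem_powersetCard.1 hY).2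
  set P : ℝ := (q ^ 2) ^ (k + 1).choose 2 with hP
  have hP0 : 0 < P := by positivity
  set y : ℝ := n * q ^ k with hy
  have hy0 : 0 ≤ y := by positivity
  set M : ℝ := ((k + 1 : ℕ) * n.choose (k + 1) : ℝ) with hM
  rw [← Finset.add_sum_erase _ _ hY]
  -- For the same clique Y, z = x gives the full weight e^y. The k other choices share k - 1
  -- dominating vertices and give e^(qy) each, together at most e^y/(1 - q) because k ≤ y.
  have hdiag : ∑ z ∈ Y, overlapWeight q n k (Y ∩ Y).card (Y.erase x ∩ Y.erase z).card ≤
      2 * Real.exp 2 * (1 + 1 / (1 - q)) * M := by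
    have h1 : ∀ z ∈ Y.erase x, overlapWeight q n k (Y ∩ Y).card (Y.erase x ∩ Y.erase z).card =
        P⁻¹ * Real.exp (y * q) := by
      intro z hz
      have e1 : Y.erase x ∩ Y.erase z = (Y.erase x).erase z := by
        ext w; simp; tauto
      have hk := h.one_le
      have e2 : k - ((Y.erase x).erase z).card = 1 := by
        rw [Finset.card_erase_of_mem hz, card_erase_of_mem_powersetCard hY hx]; omega
      rw [overlapWeight, e1, e2, Finset.inter_self, hYc, pow_one]
    rw [← Finset.add_sum_erase _ _ hx, Finset.sum_congr rfl h1, Finset.sum_const,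
      card_erase_of_mem_powersetCard hY hx, Finset.inter_self, Finset.inter_self,
      card_erase_of_mem_powersetCard hY hx, hYc, overlapWeight, Nat.sub_self, pow_zero, mul_one,
      nsmul_eq_mul]
    have h2 : P⁻¹ * Real.exp y ≤ 2 * Real.exp 2 * M := by
      have h5 := h.expected_ge
      rw [← hM, ← hP, ← hy, Real.exp_neg, Real.exp_neg] at h5
      have hE := Real.exp_pos y
      have hE2 := Real.exp_pos 2
      rw [inv_mul_le_iff₀ hP0]
      calc Real.exp y = 2 * Real.exp 2 * Real.exp y * ((Real.exp 2)⁻¹ / 2) := by field_simp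
        _ ≤ 2 * Real.exp 2 * Real.exp y * (M * (P * (Real.exp y)⁻¹)) := by gcongr
        _ = _ := by field_simp
    have h3 : k * Real.exp (y * q) ≤ 1 / (1 - q) * Real.exp y := by
      have hky : (k : ℝ) ≤ y := h.le_mean
      clear_value y
      calc k * Real.exp (y * q) ≤ y * Real.exp (y * q) := by gcongr
        _ = (y * Real.exp (-((1 - q) * y))) * Real.exp y := by
          rw [mul_assoc y, ← Real.exp_add]; ring_nf
        _ ≤ _ := by gcongr; exact mul_exp_neg_le hq1
    calc P⁻¹ * Real.exp y + k * (P⁻¹ * Real.exp (y * q))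
        = P⁻¹ * Real.exp y + P⁻¹ * (k * Real.exp (y * q)) := by ring
      _ ≤ P⁻¹ * Real.exp y + P⁻¹ * (1 / (1 - q) * Real.exp y) := by gcongr
      _ = (1 + 1 / (1 - q)) * (P⁻¹ * Real.exp y) := by ring
      _ ≤ (1 + 1 / (1 - q)) * (2 * Real.exp 2 * M) := by gcongr
      _ = _ := by ring
  have hoff : ∑ Z ∈ ((Finset.univ : Finset (Fin n)).powersetCard (k + 1)).erase Y, ∑ z ∈ Z,
      overlapWeight q n k (Y ∩ Z).card (Y.erase x ∩ Z.erase z).card ≤ 8 * Real.exp 2 * M := by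
    -- The weight increases with the dominating overlap, which is at most the clique overlap l. The
    -- cut-off removes l = k + 1, that is Z = Y, so the sum can run over all Z.
    set F : ℕ → ℝ := fun l => if l ≤ k then overlapWeight q n k l l else 0 with hF
    have hF0 : ∀ l, 0 ≤ F l := by
      intro l
      simp only [hF]
      split_ifs
      · exact overlapWeight_nonneg _ _ _ _ _
      · exact le_rfl
    have hZ : ∀ Z ∈ ((Finset.univ : Finset (Fin n)).powersetCard (k + 1)).erase Y,
        ∑ z ∈ Z, overlapWeight q n k (Y ∩ Z).card (Y.erase x ∩ Z.erase z).card ≤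
          (k + 1 : ℕ) * F (Y ∩ Z).card := by
      intro Z hZ
      obtain ⟨hne, hZm⟩ := Finset.mem_erase.1 hZ
      have hZc := (Finset.mem_powersetCard.1 hZm).2
      have hl : (Y ∩ Z).card ≤ k := by
        by_contra hlt
        have e1 : Y ∩ Z = Y := Finset.eq_of_subset_of_card_le Finset.inter_subset_left (by omega)
        have e2 : Y ∩ Z = Z := Finset.eq_of_subset_of_card_le Finset.inter_subset_right (by omega)
        exact hne (e2.symm.trans e1)
      have : ∀ z ∈ Z, overlapWeight q n k (Y ∩ Z).card (Y.erase x ∩ Z.erase z).card ≤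
          F (Y ∩ Z).card := by
        intro z _
        simp only [hF, hl, if_true, overlapWeight]
        have hi : (Y.erase x ∩ Z.erase z).card ≤ (Y ∩ Z).card :=
          Finset.card_le_card (Finset.inter_subset_inter (Finset.erase_subset _ _)
            (Finset.erase_subset _ _))
        have hpow : q ^ (k - (Y.erase x ∩ Z.erase z).card) ≤ q ^ (k - (Y ∩ Z).card) :=
          pow_le_pow_of_le_one hq.le h.lt_one.le (by omega)
        gcongr
      refine (Finset.sum_le_card_nsmul _ _ _ this).trans (le_of_eq ?_)
      rw [hZc, nsmul_eq_mul]
    calc _ ≤ ∑ Z ∈ ((Finset.univ : Finset (Fin n)).powersetCard (k + 1)).erase Y,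
          ((k + 1 : ℕ) : ℝ) * F (Y ∩ Z).card := Finset.sum_le_sum hZ
      _ ≤ ∑ Z ∈ (Finset.univ : Finset (Fin n)).powersetCard (k + 1),
          ((k + 1 : ℕ) : ℝ) * F (Y ∩ Z).card :=
        Finset.sum_le_sum_of_subset_of_nonneg (Finset.erase_subset _ _) fun Z _ _ =>
          mul_nonneg (Nat.cast_nonneg _) (hF0 _)
      _ = ((k + 1 : ℕ) : ℝ) * ∑ Z ∈ (Finset.univ : Finset (Fin n)).powersetCard (k + 1),
          F (Y ∩ Z).card := by rw [Finset.mul_sum]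
      _ ≤ ((k + 1 : ℕ) : ℝ) * (8 * Real.exp 2 * n.choose (k + 1)) := by
        gcongr
        refine (sum_card_inter_le (Finset.subset_univ Y) (k + 1) hF0).trans ?_
        rw [Finset.sum_range_succ, hYc, Finset.card_univ, Fintype.card_fin]
        have hlast : F (k + 1) = 0 := by simp [hF]
        rw [hlast, mul_zero, add_zero]
        refine le_trans (le_of_eq (Finset.sum_congr rfl fun l hl => ?_)) h.sum_overlap_le
        have hlk : l ≤ k := by simp at hl; omega
        simp only [hF, hlk, if_true, overlapWeight]
      _ = _ := by rw [hM]; ring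
  rw [add_mul]
  exact add_le_add hdiag hoff

lemma DenseRegime.real_inter_le {p : I} (h : DenseRegime q n k) (hq : q = 1 - p)
    (hp : (p : ℝ) = q ^ 2) {Y Z : Finset (Fin n)}
    (hY : Y ∈ (Finset.univ : Finset (Fin n)).powersetCard (k + 1))
    (hZ : Z ∈ (Finset.univ : Finset (Fin n)).powersetCard (k + 1)) {x z : Fin n} (hx : x ∈ Y)
    (hz : z ∈ Z) :
    (SimpleGraph.binomialRandom (Fin n) p).real
      (dominatingEvent (Y.erase x) Y ∩ dominatingEvent (Z.erase z) Z) ≤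
      Real.exp 2 * ((p : ℝ) ^ (k + 1).choose 2 * (1 - q ^ k) ^ (n - (k + 1))) ^ 2 *
        overlapWeight q n k (Y ∩ Z).card (Y.erase x ∩ Z.erase z).card := by
  have hpos := h.pos
  have hYc := (Finset.mem_powersetCard.1 hY).2
  have hZc := (Finset.mem_powersetCard.1 hZ).2
  have hXc := card_erase_of_mem_powersetCard hY hx
  have hWc := card_erase_of_mem_powersetCard hZ hz
  have hi : (Y.erase x ∩ Z.erase z).card ≤ k :=
    hXc ▸ Finset.card_le_card Finset.inter_subset_left
  have hunion : (Y.erase x ∪ Z.erase z).card = k + (k - (Y.erase x ∩ Z.erase z).card) := by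
    have := Finset.card_union_add_card_inter (Y.erase x) (Z.erase z)
    omega
  have h1 := real_dominatingEvent_inter_le p (Finset.erase_subset x Y) (Finset.erase_subset z Z)
  rw [← hq, hXc, hWc, hunion, hYc, hZc, Fintype.card_fin] at h1
  have h2 := h.pair_dominating_le (i := (Y.erase x ∩ Z.erase z).card) (s := (Y ∪ Z).card)
    ((Finset.card_union_le _ _).trans (by omega)) (by simpa using Finset.card_le_univ (Y ∪ Z))
  have h3 := h.dominating_ge
  -- Turns e^(-2y) back into the square of the single domination probability; with the 1 from the
  -- joint bound this yields the constant e².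
  have h4 : Real.exp (-(2 * (n * q ^ k)) - 1) ≤ ((1 - q ^ k) ^ (n - (k + 1))) ^ 2 := by
    refine le_trans (le_of_eq ?_) (pow_le_pow_left₀ (Real.exp_pos _).le h3 2)
    rw [← Real.exp_nat_mul]
    push_cast
    ring_nf
  have hQ : 0 < (p : ℝ) ^ (Y ∩ Z).card.choose 2 := by rw [hp]; positivity
  refine le_of_mul_le_mul_right (h1.trans ?_) hQ
  generalize (Y.erase x ∩ Z.erase z).card = i at *
  calc _ ≤ (p : ℝ) ^ (k + 1).choose 2 * (p : ℝ) ^ (k + 1).choose 2 *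
        Real.exp (-(2 * (n * q ^ k)) + n * q ^ k * q ^ (k - i) + 1) := by
        have : 0 ≤ (p : ℝ) := p.2.1
        gcongr
    _ = ((p : ℝ) ^ (k + 1).choose 2) ^ 2 * (Real.exp 2 * Real.exp (-(2 * (n * q ^ k)) - 1) *
        Real.exp (n * q ^ k * q ^ (k - i))) := by
        rw [← Real.exp_add, ← Real.exp_add]; ring_nf
    _ ≤ ((p : ℝ) ^ (k + 1).choose 2) ^ 2 * (Real.exp 2 * ((1 - q ^ k) ^ (n - (k + 1))) ^ 2 *
        Real.exp (n * q ^ k * q ^ (k - i))) := by gcongr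
    _ = _ := by
        rw [overlapWeight, ← hp]
        field_simp

lemma DenseRegime.le_prob_not_phiC3 {p : I} (h : DenseRegime q n k) (hq : q = 1 - p)
    (hp : (p : ℝ) = q ^ 2) :
    (Real.exp 2 * (2 * Real.exp 2 * (1 + 1 / (1 - q)) + 8 * Real.exp 2))⁻¹ ≤
      prob n p fun G => ¬ PhiC3 G := by
  have hpos := h.pos
  have hq1 : 0 < 1 - q := by linarith [h.lt_one]
  set S := (Finset.univ : Finset (Fin n)).powersetCard (k + 1) with hS
  -- A violation is indexed by a (k+1)-clique Y and the vertex of Y whose removal leaves the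
  -- dominating clique.
  set s : Finset (Σ _ : Finset (Fin n), Fin n) := S.sigma fun Y => Y with hs
  set A : (Σ _ : Finset (Fin n), Fin n) → Set (SimpleGraph (Fin n)) :=
    fun c => dominatingEvent (c.1.erase c.2) c.1 with hA
  set a : ℝ := (p : ℝ) ^ (k + 1).choose 2 * (1 - q ^ k) ^ (n - (k + 1)) with ha
  set M : ℝ := ((k + 1 : ℕ) * n.choose (k + 1) : ℝ) with hM
  set C : ℝ := 2 * Real.exp 2 * (1 + 1 / (1 - q)) + 8 * Real.exp 2 with hC
  have hC0 : 0 < C := by positivity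
  have ha0 : 0 < a := by
    rw [ha, hp]
    have := lt_of_lt_of_le (Real.exp_pos _) h.dominating_ge
    positivity
  have hM0 : 0 < M := by
    by_contra hM0
    have h1 := h.expected_ge
    rw [← hM] at h1
    have h2 : 0 < Real.exp (-2) / 2 := by positivity
    have h3 : 0 ≤ (q ^ 2) ^ (k + 1).choose 2 * Real.exp (-(n * q ^ k)) := by positivity
    nlinarith
  have hPA : ∀ c ∈ s, (SimpleGraph.binomialRandom (Fin n) p).real (A c) = a := by
    intro c hc
    obtain ⟨hc1, hc2⟩ := Finset.mem_sigma.1 hc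
    rw [hA]
    simp only
    rw [real_dominatingEvent p (Finset.erase_subset _ _), card_erase_of_mem_powersetCard hc1 hc2,
      (Finset.mem_powersetCard.1 hc1).2, Fintype.card_fin, ← hq]
  have hcard : (s.card : ℝ) = M := by
    rw [hs, Finset.card_sigma, Finset.sum_congr rfl fun Y hY => (Finset.mem_powersetCard.1 hY).2,
      Finset.sum_const, Finset.card_powersetCard, Finset.card_univ, Fintype.card_fin, hM]
    push_cast
    rw [nsmul_eq_mul]
    push_cast
    ring
  have h2 := sq_sum_le_real_biUnion_mul (SimpleGraph.binomialRandom (Fin n) p) s A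
  rw [Finset.sum_congr rfl hPA, Finset.sum_const, nsmul_eq_mul, hcard] at h2
  have hsum : ∑ c ∈ s, ∑ d ∈ s, (SimpleGraph.binomialRandom (Fin n) p).real (A c ∩ A d) ≤
      M * (Real.exp 2 * a ^ 2 * (C * M)) := by
    rw [← hcard, ← nsmul_eq_mul]
    refine Finset.sum_le_card_nsmul _ _ _ fun c hc => ?_
    obtain ⟨hc1, hc2⟩ := Finset.mem_sigma.1 hc
    rw [hs, Finset.sum_sigma, hcard]
    calc _ ≤ ∑ Z ∈ S, ∑ z ∈ Z, Real.exp 2 * a ^ 2 *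
          overlapWeight q n k (c.1 ∩ Z).card (c.1.erase c.2 ∩ Z.erase z).card :=
        Finset.sum_le_sum fun Z hZ => Finset.sum_le_sum fun z hz =>
          h.real_inter_le hq hp hc1 hZ hc2 hz
      _ = Real.exp 2 * a ^ 2 * ∑ Z ∈ S, ∑ z ∈ Z,
          overlapWeight q n k (c.1 ∩ Z).card (c.1.erase c.2 ∩ Z.erase z).card := by
        simp_rw [Finset.mul_sum]
      _ ≤ _ := by
        gcongr
        exact h.sum_overlapWeight_le hc1 hc2
  have hU : (SimpleGraph.binomialRandom (Fin n) p).real (⋃ c ∈ s, A c) ≤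
      prob n p fun G => ¬ PhiC3 G := by
    refine measureReal_mono ?_
    intro G hG
    simp only [Set.mem_iUnion] at hG
    obtain ⟨c, hc, hG⟩ := hG
    obtain ⟨hc1, hc2⟩ := Finset.mem_sigma.1 hc
    refine not_phiC3_of_mem_dominatingEvent (X := c.1.erase c.2) ?_
      (Finset.notMem_erase c.2 c.1) ?_
    · rw [← Finset.card_pos, card_erase_of_mem_powersetCard hc1 hc2]
      exact h.one_le
    · rw [Finset.insert_erase hc2]
      exact hG
  have h5 : (M * a) ^ 2 ≤ (prob n p fun G => ¬ PhiC3 G) *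
      (M * (Real.exp 2 * a ^ 2 * (C * M))) :=
    h2.trans (mul_le_mul hU hsum (Finset.sum_nonneg fun _ _ => Finset.sum_nonneg fun _ _ =>
      measureReal_nonneg) (prob_nonneg _ _ _))
  rw [inv_le_iff_one_le_mul₀ (by positivity)]
  refine le_of_mul_le_mul_left ?_ (show 0 < (M * a) ^ 2 by positivity)
  calc _ = (M * a) ^ 2 := by ring
    _ ≤ _ := h5
    _ = _ := by ring

/-- Orders along which the expected number of extendable dominating cliques at the critical density
is bounded below. -/
noncomputable def denseOrder (q : ℝ) (m : ℕ) : ℕ := ⌈m / q ^ m⌉₊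

lemma eventually_denseRegime (h0 : 0 < q) (h1 : q < 1) :
    ∀ᶠ m in atTop, DenseRegime q (denseOrder q m) m := by
  have hs0 : 0 < √q := Real.sqrt_pos.2 h0
  have hs1 : √q < 1 := by rw [Real.sqrt_lt' one_pos]; simpa using h1
  have t : ∀ j : ℕ, Tendsto (fun m : ℕ => ((m : ℝ) + 1) ^ j * √q ^ m) atTop (𝓝 0) := by
    intro j
    have h := ((tendsto_pow_const_mul_const_pow_of_abs_lt_one j
      (r := √q) (by rwa [abs_of_pos hs0])).comp (tendsto_add_atTop_nat 1)).mul_const (√q)⁻¹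
    rw [zero_mul] at h
    refine h.congr fun m => ?_
    simp only [Function.comp]
    rw [pow_succ]
    push_cast
    field_simp
  have t1 : Tendsto (fun m : ℕ => (((m : ℝ) + 1) ^ 1 * √q ^ m) * (√q)⁻¹) atTop (𝓝 0) := by
    simpa using (t 1).mul_const (√q)⁻¹
  filter_upwards [eventually_ge_atTop 1,
    (t 3).eventually_le_const (show (0 : ℝ) < 1 / 4 by norm_num), t1.eventually_le_const one_pos]
    with m hm h3 hlin
  have hqm : 0 < q ^ m := by positivity
  refine ⟨h0, h1, hm, ?_, ?_, h3, ?_⟩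
  · have : (m : ℝ) / q ^ m ≤ denseOrder q m := Nat.le_ceil _
    rwa [div_le_iff₀ hqm] at this
  · have h : (denseOrder q m : ℝ) < m / q ^ m + 1 := Nat.ceil_lt_add_one (by positivity)
    have h4 : (denseOrder q m : ℝ) * q ^ m ≤ (m / q ^ m + 1) * q ^ m := by gcongr
    rw [add_mul, div_mul_cancel₀ _ hqm.ne', one_mul] at h4
    linarith [pow_le_one₀ (n := m) h0.le h1.le]
  · refine le_trans (le_of_eq ?_) hlin
    obtain ⟨j, rfl⟩ : ∃ j, m = j + 1 := ⟨m - 1, by omega⟩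
    rw [Nat.add_sub_cancel, pow_succ √q]
    field_simp

lemma tendsto_denseOrder (h0 : 0 < q) (h1 : q < 1) : Tendsto (denseOrder q) atTop atTop := by
  refine tendsto_atTop_mono (fun m => ?_) tendsto_id
  have h : (m : ℝ) ≤ m / q ^ m := by
    rw [le_div_iff₀ (by positivity)]
    exact mul_le_of_le_one_right (by positivity) (pow_le_one₀ h0.le h1.le)
  exact_mod_cast h.trans (Nat.le_ceil _)

lemma not_tendsto_prob_phiC3 (p : I) (hp0 : 0 < (p : ℝ)) (hp1 : (p : ℝ) < 1)
    (hp : (p : ℝ) = (1 - p) ^ 2) :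
    ¬ ∃ L : ℝ, Tendsto (fun n => prob n p fun G => PhiC3 G) atTop (𝓝 L) := by
  rintro ⟨L, hL⟩
  have hq0 : (0 : ℝ) < 1 - p := by linarith
  have hq1 : (1 - p : ℝ) < 1 := by linarith
  have hL1 : L = 1 := tendsto_nhds_unique (hL.comp (tendsto_sparseOrder hq0 hq1))
    (tendsto_prob_phiC3_sparseOrder p hp0 hp1 hp)
  have hd := (hL.comp (tendsto_denseOrder hq0 hq1)).const_sub 1
  rw [hL1, sub_self] at hd
  have hpp : 0 < 1 - (1 - p : ℝ) := by linarith
  set c : ℝ := (Real.exp 2 * (2 * Real.exp 2 * (1 + 1 / (1 - (1 - p : ℝ))) + 8 * Real.exp 2))⁻¹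
    with hc
  have hc0 : 0 < c := by positivity
  refine absurd (ge_of_tendsto hd (b := c) ?_) (not_le.2 hc0)
  filter_upwards [eventually_denseRegime hq0 hq1] with m hm
  have := hm.le_prob_not_phiC3 rfl hp
  rwa [prob_not] at this

end CriticalSecondMoment

/-! ### Transfer to independent sets, and the quadratic behind the thresholds. -/

section Symmetry

lemma not_adj_iff_compl_adj {V : Type*} {G : SimpleGraph V} {X : Set V} {x y : V} (hx : x ∉ X)
    (hy : y ∈ X) : ¬ G.Adj x y ↔ Gᶜ.Adj x y := by
  have : x ≠ y := fun h => hx (h ▸ hy)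
  simp [SimpleGraph.compl_adj, this]

lemma phiC_compl {V : Type*} (G : SimpleGraph V) (X : Set V) : PhiC Gᶜ X ↔ PhiI G X := by
  refine exists_congr fun x => and_congr_right fun hx => forall₂_congr fun y hy => ?_
  rw [← not_adj_iff_compl_adj hx hy, not_not]

lemma maxCl_compl {V : Type*} (G : SimpleGraph V) (X : Set V) : MaxCl Gᶜ X ↔ MaxInd G X := by
  refine and_congr (SimpleGraph.isClique_compl G) (not_congr ?_)
  exact exists_congr fun x => and_congr_right fun hx => forall₂_congr fun y hy =>
    (not_adj_iff_compl_adj hx hy).symm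

lemma phiC1_compl {V : Type*} (G : SimpleGraph V) : PhiC1 Gᶜ ↔ PhiI1 G := by
  simp [PhiC1, PhiI1, phiC_compl]

lemma phiC2_compl {V : Type*} (G : SimpleGraph V) : PhiC2 Gᶜ ↔ PhiI2 G := by
  simp [PhiC2, PhiI2, phiC_compl, maxCl_compl]

lemma phiC3_compl {V : Type*} (G : SimpleGraph V) : PhiC3 Gᶜ ↔ PhiI3 G := by
  simp [PhiC3, PhiI3, phiC_compl, maxCl_compl]

lemma prob_compl (n : ℕ) (p : I) (Q : SimpleGraph (Fin n) → Prop) :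
    prob n p (fun G => Q Gᶜ) = prob n (σ p) Q :=
  real_compl_graph p Q

lemma sq_sub_eq_zero_factor (p : ℝ) :
    (1 - p) ^ 2 - p = ((3 - √5) / 2 - p) * ((3 + √5) / 2 - p) := by
  have : √5 * √5 = 5 := Real.mul_self_sqrt (by norm_num)
  nlinarith

lemma sqrt_five_pos : 0 < √5 := by positivity

lemma golden_lt_iff {p : ℝ} (hp : p < 1) : (3 - √5) / 2 < p ↔ (1 - p) ^ 2 < p := by
  have h := sq_sub_eq_zero_factor p
  have h5 : 0 < (3 + √5) / 2 - p := by linarith [sqrt_five_pos]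
  constructor <;> intro h1 <;> nlinarith

lemma lt_golden_iff {p : ℝ} (hp : p < 1) : p < (3 - √5) / 2 ↔ p < (1 - p) ^ 2 := by
  have h := sq_sub_eq_zero_factor p
  have h5 : 0 < (3 + √5) / 2 - p := by linarith [sqrt_five_pos]
  constructor <;> intro h1 <;> nlinarith

lemma eq_golden_iff {p : ℝ} (hp : p < 1) : p = (3 - √5) / 2 ↔ p = (1 - p) ^ 2 := by
  have h1 := golden_lt_iff hp
  have h2 := lt_golden_iff hp
  constructor <;> intro h <;> apply le_antisymm <;> by_contra hc <;> push Not at hc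
  · exact absurd (h1.2 hc) (by linarith)
  · exact absurd (h2.2 hc) (by linarith)
  · exact absurd (h1.1 hc) (by linarith)
  · exact absurd (h2.1 hc) (by linarith)

end Symmetry

end CliqueSentences

open CliqueSentences Filter Topology in
theorem lemma1 (p : unitInterval) (hp0 : 0 < (p : ℝ)) (hp1 : (p : ℝ) < 1) :
    ((3 - √5) / 2 < (p : ℝ) →
      Tendsto (fun n : ℕ => prob n p (fun G => ¬ PhiC1 G ∧ ¬ PhiC2 G ∧ ¬ PhiC3 G)) atTop (𝓝 1)) ∧
    ((p : ℝ) < (3 - √5) / 2 →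
      Tendsto (fun n : ℕ => prob n p (fun G => PhiC1 G)) atTop (𝓝 1)) ∧
    ((p : ℝ) = (3 - √5) / 2 →
      ¬ ∃ L : ℝ, Tendsto (fun n : ℕ => prob n p (fun G => PhiC3 G)) atTop (𝓝 L)) ∧
    ((p : ℝ) < (√5 - 1) / 2 →
      Tendsto (fun n : ℕ => prob n p (fun G => ¬ PhiI1 G ∧ ¬ PhiI2 G ∧ ¬ PhiI3 G)) atTop (𝓝 1)) ∧
    ((√5 - 1) / 2 < (p : ℝ) →
      Tendsto (fun n : ℕ => prob n p (fun G => PhiI1 G)) atTop (𝓝 1)) ∧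
    ((p : ℝ) = (√5 - 1) / 2 →
      ¬ ∃ L : ℝ, Tendsto (fun n : ℕ => prob n p (fun G => PhiI3 G)) atTop (𝓝 L)) := by
  have hs : ((unitInterval.symm p : unitInterval) : ℝ) = 1 - p := rfl
  have hs0 : 0 < ((unitInterval.symm p : unitInterval) : ℝ) := by rw [hs]; linarith
  have hs1 : ((unitInterval.symm p : unitInterval) : ℝ) < 1 := by rw [hs]; linarith
  -- Statements on independent sets become statements on cliques at density 1 - p, and 1 - (3-√5)/2
  -- = (√5-1)/2.
  simp only [← phiC1_compl, ← phiC2_compl, ← phiC3_compl]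
  simp only [prob_compl _ p PhiC1, prob_compl _ p PhiC3,
    prob_compl _ p fun G => ¬ PhiC1 G ∧ ¬ PhiC2 G ∧ ¬ PhiC3 G]
  refine ⟨fun h => ?_, fun h => ?_, fun h => ?_, fun h => ?_, fun h => ?_, fun h => ?_⟩
  · exact tendsto_prob_not_phiC p hp0 hp1 ((golden_lt_iff hp1).1 h)
  · exact tendsto_prob_phiC1 p hp0 hp1 ((lt_golden_iff hp1).1 h)
  · exact not_tendsto_prob_phiC3 p hp0 hp1 ((eq_golden_iff hp1).1 h)
  · exact tendsto_prob_not_phiC _ hs0 hs1 ((golden_lt_iff hs1).1 (by rw [hs]; linarith))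
  · exact tendsto_prob_phiC1 _ hs0 hs1 ((lt_golden_iff hs1).1 (by rw [hs]; linarith))
  · exact not_tendsto_prob_phiC3 _ hs0 hs1 ((eq_golden_iff hs1).1 (by rw [hs]; linarith))
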